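/- Let $S$ be a system in classical first-order logic with identity whose language has the constant $0$, the successor symbol and a function symbol for (each definition of) each primitive recursive function. Assume that the set of nonlogical axioms of $S$ is a primitive recursive set of sentences, and that $S$ proves $Sx\neq 0$, $Sx=Sy\supset x=y$ and the recursion equations of all primitive recursive function symbols. Fix a standard Gödel numbering of finite sequences of formulas. A $\Pi^0_2$ statement is a sentence $\forall x\exists y\,A(x,y)$ with $A$ quantifier-free; write $\bar n$ for the numeral of $n$. $S$ is $\omega$-consistent if there is no formula $A(x)$ such that $S$ proves $\exists x\,A(x)$ and also $\neg A(\bar n)$ for every $n$; it is $1$-consistent (respectively $2$-consistent) if there is no such $A$ that is quantifier-free (respectively of the form $\forall y\,B$ with $B$ quantifier-free). The relations "$x_1$ proves a $\Pi^0_2$ statement" and "$x_1$ proves a $\Pi^0_2$ statement $\forall x\exists y\,A(x,y)$ and $y$ proves an instance $A(\bar x_2,\bar n)$ of it, for some $n$" are primitive recursive. Let $f$ and $g$ be any primitive recursive function symbols such that, for all natural numbers, these relations hold if and only if $f(x_1)=1$, respectively $g(x_1,x_2,y)=1$, and let $(*)$ be the sentence $$\forall x_1\forall x_2\,\bigl(f(x_1)=1\supset\exists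 y\;g(x_1,x_2,y)=1\bigr).$$ Then: 1. If $S$ is inconsistent, $(*)$ is true (in the natural numbers). 2. If $S$ is $1$-consistent, $(*)$ is true but not provable in $S$. 3. If $S$ is inconsistent or $1$-consistent, every numerical instance $f(\bar x_1)=1\supset\exists y\,g(\bar x_1,\bar x_2,y)=1$ is provable in $S$. Primitive recursive pairing functions exist. Let $\pi$ be any primitive recursive pairing function with primitive recursive projections $l,r$ (that is, $l(\pi(a,b))=a$ and $r(\pi(a,b))=b$ for all $a,b$), given by function symbols, and let $(*)^c$ be the contracted form $$\forall z\exists y\,\bigl(f(l(z))=1\supset g(l(z),r(z),y)=1\bigr).$$ Then 1–3 hold for $(*)^c$ as well (its numerical instances being obtained by substituting $\bar z$ for $z$), and $S$ proves $(*)\supset(*)^c$. If $S$ is $2$-consistent, and also if $S$ is $\omega$-consistent, $(*)^c$ is neither provable nor refutable in $S$. If moreover $S$ proves $l(\pi(x,y))=x$ and $r(\pi(x,y))=y$, then $S$ proves $(*)^c\supset(*)$, and if $S$ is then $2$-consistent or $\omega$-consistent, $(*)$ itself is neither provable nor refutable in $S$. -/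

import Mathlib

namespace Kripke

/-- Function symbols for the primitive recursive functions, one for each definition by
composition and primitive recursion from zero, successor and the projections. -/
inductive PR : ℕ → Type
  | zero : PR 0
  | succ : PR 1
  | proj {n : ℕ} (i : Fin n) : PR n
  | comp {m n : ℕ} (f : PR m) (g : Fin m → PR n) : PR n
  | prec {n : ℕ} (f : PR n) (g : PR (n + 2)) : PR (n + 1)

/-- The primitive recursive function denoted by a function symbol. -/
def PR.eval : {n : ℕ} → PR n → (Fin n → ℕ) → ℕ
  | _, .zero, _ => 0
  | _, .succ, v => v 0 + 1
  | _, .proj i, v => v i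
  | _, .comp f g, v => f.eval fun j => (g j).eval v
  | _, .prec f g, v =>
      Nat.rec (f.eval (Matrix.vecTail v))
        (fun y ih => g.eval (Matrix.vecCons y (Matrix.vecCons ih (Matrix.vecTail v))))
        (Matrix.vecHead v)

/-- Terms of first-order arithmetic. Variables are de Bruijn indices: under `k` quantifiers,
the indices below `k` are bound (`0` by the innermost quantifier), the others are free. -/
inductive Term : Type
  | var (k : ℕ) : Term
  | app {n : ℕ} (f : PR n) (ts : Fin n → Term) : Term

/-- Formulas of first-order arithmetic with identity. -/
inductive Formula : Type
  | eq (s t : Term) : Formula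
  | neg (A : Formula) : Formula
  | imp (A B : Formula) : Formula
  | all (A : Formula) : Formula

/-- `∃`, defined as `¬∀¬`. -/
def Formula.ex (A : Formula) : Formula := .neg (.all (.neg A))

def Term.zero : Term := .app .zero ![]

def Term.succ (t : Term) : Term := .app .succ ![t]

/-- The numeral `0⁽ⁿ⁾`. -/
def numeral : ℕ → Term
  | 0 => .zero
  | n + 1 => (numeral n).succ

/-! ### Substitution -/

/-- Add one to all variables with index at least `c`. -/
def Term.lift (c : ℕ) : Term → Term
  | .var i => if i < c then .var i else .var (i + 1)
  | .app f ts => .app f fun j => (ts j).lift c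

def Formula.lift (c : ℕ) : Formula → Formula
  | .eq s t => .eq (s.lift c) (t.lift c)
  | .neg A => .neg (A.lift c)
  | .imp A B => .imp (A.lift c) (B.lift c)
  | .all A => .all (A.lift (c + 1))

/-- Replace the variable with index `c` by `u`, and lower the indices above `c` by one. -/
def Term.subst : Term → ℕ → Term → Term
  | .var i, c, u => if i < c then .var i else if i = c then u else .var (i - 1)
  | .app f ts, c, u => .app f fun j => (ts j).subst c u

def Formula.subst : Formula → ℕ → Term → Formula
  | .eq s t, c, u => .eq (s.subst c u) (t.subst c u)
  | .neg A, c, u => .neg (A.subst c u)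
  | .imp A B, c, u => .imp (A.subst c u) (B.subst c u)
  | .all A, c, u => .all (A.subst (c + 1) (u.lift 0))

/-- `A(0⁽ⁿ⁾)`, for a formula `A(x)` with `x` the variable `0`. -/
def Formula.inst (A : Formula) (n : ℕ) : Formula := A.subst 0 (numeral n)

/-- `A(0⁽ᵐ⁾, 0⁽ⁿ⁾)`, for a formula `A(x, y)` with `x` the variable `1` and `y` the variable `0`
(so that `(x)(∃y)A(x, y)` is `A.ex.all`). -/
def Formula.inst₂ (A : Formula) (m n : ℕ) : Formula := (A.inst n).inst m

/-- All variables of the term have index below `n`. -/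
def Term.Below (n : ℕ) : Term → Prop
  | .var i => i < n
  | .app _ ts => ∀ j, (ts j).Below n

/-- All free variables of the formula have index below `n`. -/
def Formula.Below : ℕ → Formula → Prop
  | n, .eq s t => s.Below n ∧ t.Below n
  | n, .neg A => A.Below n
  | n, .imp A B => A.Below n ∧ B.Below n
  | n, .all A => A.Below (n + 1)

/-- A sentence: no free variables. -/
def Formula.Closed (A : Formula) : Prop := A.Below 0

def Formula.QuantifierFree : Formula → Prop
  | .eq _ _ => True
  | .neg A => A.QuantifierFree
  | .imp A B => A.QuantifierFree ∧ B.QuantifierFree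
  | .all _ => False

/-! ### Truth in the standard model -/

def Term.eval (v : ℕ → ℕ) : Term → ℕ
  | .var i => v i
  | .app f ts => f.eval fun j => (ts j).eval v

/-- The assignment `a, v 0, v 1, …`. -/
def extend (a : ℕ) (v : ℕ → ℕ) : ℕ → ℕ
  | 0 => a
  | i + 1 => v i

def Formula.Holds : Formula → (ℕ → ℕ) → Prop
  | .eq s t, v => s.eval v = t.eval v
  | .neg A, v => ¬ A.Holds v
  | .imp A B, v => A.Holds v → B.Holds v
  | .all A, v => ∀ a : ℕ, A.Holds (extend a v)

/-- Truth, in the natural numbers, of the universal closure; for a sentence, truth. -/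
def Formula.IsTrue (A : Formula) : Prop := ∀ v, A.Holds v

/-! ### Gödel numbering -/

def PR.code : {n : ℕ} → PR n → ℕ
  | _, .zero => Nat.pair 0 0
  | _, .succ => Nat.pair 1 0
  | _, .proj i => Nat.pair 2 i
  | _, .comp (m := m) f g =>
      Nat.pair 3 (Nat.pair m (Nat.pair f.code (Encodable.encode (List.ofFn fun j => (g j).code))))
  | _, .prec f g => Nat.pair 4 (Nat.pair f.code g.code)

def Term.code : Term → ℕ
  | .var i => Nat.pair 0 i
  | .app (n := n) f ts =>
      Nat.pair 1 (Nat.pair n (Nat.pair f.code (Encodable.encode (List.ofFn fun j => (ts j).code))))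

def Formula.code : Formula → ℕ
  | .eq s t => Nat.pair 0 (Nat.pair s.code t.code)
  | .neg A => Nat.pair 1 A.code
  | .imp A B => Nat.pair 2 (Nat.pair A.code B.code)
  | .all A => Nat.pair 3 A.code

/-- The Gödel number of a finite sequence of formulas. -/
def codeSeq (l : List Formula) : ℕ := Encodable.encode (l.map Formula.code)

/-! ### Proofs -/

/-- Axioms of first-order logic with identity, for a calculus with the rules modus ponens
and generalization. -/
inductive LogicalAxiom : Formula → Prop
  | imp₁ (A B : Formula) : LogicalAxiom (.imp A (.imp B A))
  | imp₂ (A B C : Formula) :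
      LogicalAxiom (.imp (.imp A (.imp B C)) (.imp (.imp A B) (.imp A C)))
  | contra (A B : Formula) : LogicalAxiom (.imp (.imp (.neg A) (.neg B)) (.imp B A))
  | spec (A : Formula) (t : Term) : LogicalAxiom (.imp (.all A) (A.subst 0 t))
  | dist (A B : Formula) : LogicalAxiom (.imp (.all (.imp A B)) (.imp (.all A) (.all B)))
  | vacuous (A : Formula) : LogicalAxiom (.imp A (.all (A.lift 0)))
  | refl (t : Term) : LogicalAxiom (.eq t t)
  | eucl (s t u : Term) : LogicalAxiom (.imp (.eq s t) (.imp (.eq s u) (.eq t u)))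
  | congr {n : ℕ} (f : PR n) (ts : Fin n → Term) (i : Fin n) (s t : Term) :
      LogicalAxiom (.imp (.eq s t)
        (.eq (.app f (Function.update ts i s)) (.app f (Function.update ts i t))))

/-- `IsProof S l`: the sequence `l`, written with its last formula first, is a proof in the system
with the set `S` of nonlogical axioms. Each formula is a logical or nonlogical axiom, or it
follows from formulas that come before it by modus ponens or generalization. -/
def IsProof (S : Set Formula) : List Formula → Prop
  | [] => True
  | A :: l =>
      (LogicalAxiom A ∨ A ∈ S ∨ (∃ B ∈ l, Formula.imp B A ∈ l) ∨ ∃ B ∈ l, A = .all B) ∧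
        IsProof S l

/-- The number `p` is the Gödel number of a proof of `A` in `S`. -/
def Proves (S : Set Formula) (p : ℕ) (A : Formula) : Prop :=
  ∃ l, IsProof S (A :: l) ∧ p = codeSeq (A :: l)

def Provable (S : Set Formula) (A : Formula) : Prop := ∃ p, Proves S p A

/-- The defining (recursion) equations of the primitive recursive function symbols, as open
formulas. -/
inductive RecursionEquation : Formula → Prop
  | proj {n : ℕ} (i : Fin n) :
      RecursionEquation (.eq (.app (.proj i) fun j : Fin n => .var j) (.var i))
  | comp {m n : ℕ} (f : PR m) (g : Fin m → PR n) :
      RecursionEquation (.eq (.app (.comp f g) fun j : Fin n => .var j)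
        (.app f fun k => .app (g k) fun j : Fin n => .var j))
  | prec_zero {n : ℕ} (f : PR n) (g : PR (n + 2)) :
      RecursionEquation
        (.eq (.app (.prec f g) (Matrix.vecCons .zero fun j : Fin n => .var j))
          (.app f fun j : Fin n => .var j))
  | prec_succ {n : ℕ} (f : PR n) (g : PR (n + 2)) :
      RecursionEquation
        (.eq (.app (.prec f g) (Matrix.vecCons (.succ (.var n)) fun j : Fin n => .var j))
          (.app g (Matrix.vecCons (.var n)
            (Matrix.vecCons
              (.app (.prec f g) (Matrix.vecCons (.var n) fun j : Fin n => .var j))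
              fun j : Fin n => .var j))))

/-- The systems under consideration: a primitive recursive set of first-order sentences that
implies the two successor axioms and the recursion equations. -/
structure IsArithmeticalSystem (S : Set Formula) : Prop where
  closed : ∀ A ∈ S, A.Closed
  primrec : PrimrecPred fun k : ℕ => ∃ A ∈ S, A.code = k
  succ_ne_zero : Provable S (.neg (.eq (.succ (.var 0)) .zero))
  succ_inj : Provable S (.imp (.eq (.succ (.var 1)) (.succ (.var 0))) (.eq (.var 1) (.var 0)))
  recursion : ∀ A, RecursionEquation A → Provable S A

/-! ### Consistency notions -/

def Inconsistent (S : Set Formula) : Prop := ∃ A, Provable S A ∧ Provable S (.neg A)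

/-- `ω`-consistency with respect to the formulas `A(x)` in the class `Γ`: it never happens that
`(∃x)A(x)` and all of `¬A(0), ¬A(1), …` are provable. -/
def OmegaConsistentFor (S : Set Formula) (Γ : Formula → Prop) : Prop :=
  ¬ ∃ A : Formula, A.Below 1 ∧ Γ A ∧ Provable S A.ex ∧ ∀ n, Provable S (.neg (A.inst n))

def OmegaConsistent (S : Set Formula) : Prop := OmegaConsistentFor S fun _ => True

def OneConsistent (S : Set Formula) : Prop := OmegaConsistentFor S Formula.QuantifierFree

/-- `A` is a `Π⁰₁` formula `(y)B` with `B` quantifier-free. -/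
def Formula.IsPi₁ (A : Formula) : Prop := ∃ B : Formula, B.QuantifierFree ∧ A = .all B

def TwoConsistent (S : Set Formula) : Prop := OmegaConsistentFor S Formula.IsPi₁

/-! ### The statement (*) -/

/-- `p` proves the `Π⁰₂` statement `(x)(∃y)A(x, y)`. -/
def ProvesPi₂ (S : Set Formula) (p : ℕ) (A : Formula) : Prop :=
  A.QuantifierFree ∧ A.Below 2 ∧ Proves S p A.ex.all

/-- `f(x) = 1` says: `x` proves a `Π⁰₂` statement. -/
def DefinesProvesPi₂ (S : Set Formula) (f : PR 1) : Prop :=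
  ∀ x, f.eval ![x] = 1 ↔ ∃ A, ProvesPi₂ S x A

/-- `g(x₁, x₂, y) = 1` says: `x₁` proves a `Π⁰₂` statement `(x)(∃y)A(x, y)`, and `y` proves an
instance `A(0⁽ˣ²⁾, 0⁽ⁿ⁾)` of it. -/
def DefinesProvesInstance (S : Set Formula) (g : PR 3) : Prop :=
  ∀ x₁ x₂ y, g.eval ![x₁, x₂, y] = 1 ↔
    ∃ A, ProvesPi₂ S x₁ A ∧ ∃ n, Proves S y (A.inst₂ x₂ n)

/-- The matrix `f(x₁) = 1 ⊃ (∃y) g(x₁, x₂, y) = 1`, with `x₁` the variable `1` and `x₂` the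
variable `0`. -/
def starMatrix (f : PR 1) (g : PR 3) : Formula :=
  .imp (.eq (.app f ![.var 1]) (numeral 1))
    (.ex (.eq (.app g ![.var 2, .var 1, .var 0]) (numeral 1)))

/-- The sentence (*): `(x₁)(x₂)(f(x₁) = 1 ⊃ (∃y) g(x₁, x₂, y) = 1)`. -/
def star (f : PR 1) (g : PR 3) : Formula := .all (.all (starMatrix f g))

/-- `pr` is a pairing function with projections `l` and `r`. -/
def IsPairing (pr : PR 2) (l r : PR 1) : Prop :=
  ∀ a b, l.eval ![pr.eval ![a, b]] = a ∧ r.eval ![pr.eval ![a, b]] = b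

/-- `S` proves `l(pr(x, y)) = x` and `r(pr(x, y)) = y`. -/
def ProvesPairing (S : Set Formula) (pr : PR 2) (l r : PR 1) : Prop :=
  Provable S (.eq (.app l ![.app pr ![.var 1, .var 0]]) (.var 1)) ∧
    Provable S (.eq (.app r ![.app pr ![.var 1, .var 0]]) (.var 0))

/-- The formula `(∃y)(f(l(z)) = 1 ⊃ g(l(z), r(z), y) = 1)`, with `z` the variable `0`. -/
def contractedMatrix (f : PR 1) (g : PR 3) (l r : PR 1) : Formula :=
  .ex (.imp (.eq (.app f ![.app l ![.var 1]]) (numeral 1))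
    (.eq (.app g ![.app l ![.var 1], .app r ![.var 1], .var 0]) (numeral 1)))

/-- (*) with its universal quantifiers contracted, in `Π⁰₂` normal form:
`(z)(∃y)(f(l(z)) = 1 ⊃ g(l(z), r(z), y) = 1)`. -/
def starContracted (f : PR 1) (g : PR 3) (l r : PR 1) : Formula :=
  .all (contractedMatrix f g l r)

end Kripke

namespace Kripke

/-! ### Lifting and substitution -/

/-! Truth. An arithmetical system decides closed quantifier-free formulas according to their truth
value (`decides`). Suppose `S` proves `∀x∃y A(x,y)` but no instance `A(x₂,n)` for some fixed `x₂`.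
Then `S` refutes all these instances while proving `∃y A(x₂,y)`, so it is not 1-consistent
(`exists_provable_inst₂`). An inconsistent system proves all instances anyway. Hence `(*)` is true
in both cases, and each numerical instance is provable because a true existential statement with
decidable matrix has a provable witness.

Unprovability. Suppose a 1-consistent `S` proves `(*)^c`. Putting `π(x,x)` for `z` gives a proof `q`
of a `Π⁰₂` statement `∀x∃y D(x,y)`, where `D(q,y)` amounts to `f(q) = 1 ⊃ g(q,q,y) = 1`. Here `f(q)
= 1`, so by truth some `y` satisfies `g(q,q,y) = 1`; take the least. It is the number of a proof of
some `D(q,n)`. This instance is quantifier-free, hence true, so `g(q,q,n) = 1`. But the numeral of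
`n` occurs in a formula of the proof `y`, so `n < y`, a contradiction
(`not_provable_starContracted`).

Irrefutability. The negation of `(*)^c` has the form `∃z∀y ¬…`, and every numerical instance of
`(*)^c` is provable; this contradicts 2-consistency (`starContracted_independent`). Everything about
`(*)` follows, since `S` proves `(*) ⊃ (*)^c`, and the converse once it proves the pairing
equations.

The existence of `f` and `g` is arithmetization: the syntactic operations and the proof predicate
are shown primitive recursive, with unbounded searches bounded by codes. -/

theorem Term.subst_lift (t : Term) (c : ℕ) (u : Term) : (t.lift c).subst c u = t := by
  induction t with
  | var i =>
    simp only [Term.lift]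
    split_ifs with h
    · simp [Term.subst, h]
    · have h1 : ¬ i + 1 < c := by omega
      have h2 : i + 1 ≠ c := by omega
      simp [Term.subst, h1, h2]
  | app f ts ih => simp [Term.lift, Term.subst, ih]

theorem Formula.subst_lift (A : Formula) : ∀ (c : ℕ) (u : Term), (A.lift c).subst c u = A := by
  induction A with
  | eq s t => simp [Formula.lift, Formula.subst, Term.subst_lift]
  | neg A ih => simp [Formula.lift, Formula.subst, ih]
  | imp A B ihA ihB => simp [Formula.lift, Formula.subst, ihA, ihB]
  | all A ih => simp [Formula.lift, Formula.subst, ih]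

/-- The lift makes room above `c` for the lowering done by `subst`, so renaming `c` to itself
changes nothing. This is what allows an eigenvariable to serve as the witness in `ex_intro`. -/
theorem Term.subst_lift_succ (t : Term) (c : ℕ) : (t.lift (c + 1)).subst c (.var c) = t := by
  induction t with
  | var i =>
    simp only [Term.lift]
    split_ifs with h
    · rcases Nat.lt_or_ge i c with h1 | h1
      · simp [Term.subst, h1]
      · obtain rfl : i = c := by omega
        simp [Term.subst]
    · have h1 : ¬ i + 1 < c := by omega
      have h2 : i + 1 ≠ c := by omega
      simp [Term.subst, h1, h2]
  | app f ts ih => simp [Term.lift, Term.subst, ih]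

theorem Formula.subst_lift_succ (A : Formula) :
    ∀ c : ℕ, (A.lift (c + 1)).subst c (.var c) = A := by
  induction A with
  | eq s t => simp [Formula.lift, Formula.subst, Term.subst_lift_succ]
  | neg A ih => simp [Formula.lift, Formula.subst, ih]
  | imp A B ihA ihB => simp [Formula.lift, Formula.subst, ihA, ihB]
  | all A ih => simp [Formula.lift, Formula.subst, Term.lift, ih]

theorem Term.Below.lift_eq {t : Term} {n c : ℕ} (h : t.Below n) (hc : n ≤ c) : t.lift c = t := by
  induction t with
  | var i =>
    have : i < c := lt_of_lt_of_le h hc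
    simp [Term.lift, this]
  | app f ts ih => simp only [Term.lift]; congr; funext j; exact ih j (h j)

theorem Formula.Below.lift_eq {A : Formula} :
    ∀ {n c : ℕ}, A.Below n → n ≤ c → A.lift c = A := by
  induction A with
  | eq s t => intro n c h hc; simp [Formula.lift, h.1.lift_eq hc, h.2.lift_eq hc]
  | neg A ih => intro n c h hc; simp only [Formula.lift]; rw [ih h hc]
  | imp A B ihA ihB => intro n c h hc; simp [Formula.lift, ihA h.1 hc, ihB h.2 hc]
  | all A ih =>
    intro n c h hc
    simp only [Formula.lift]
    rw [ih (n := n + 1) h (by omega)]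

theorem Term.Below.subst_eq {t : Term} {n c : ℕ} {u : Term} (h : t.Below n) (hc : n ≤ c) :
    t.subst c u = t := by
  induction t with
  | var i =>
    have : i < c := lt_of_lt_of_le h hc
    simp [Term.subst, this]
  | app f ts ih => simp only [Term.subst]; congr; funext j; exact ih j (h j)

theorem Term.Below.subst {t u : Term} {n : ℕ} (h : t.Below (n + 1)) (hu : u.Below 0) :
    ∀ {c : ℕ}, c ≤ n → (t.subst c u).Below n := by
  have mono : ∀ {u : Term}, u.Below 0 → u.Below n := by
    intro u hu
    induction u with
    | var i => exact absurd hu (Nat.not_lt_zero i)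
    | app f ts ih => exact fun j => ih j (hu j)
  intro c hc
  induction t with
  | var i =>
    have hi : i < n + 1 := h
    simp only [Term.subst]
    split_ifs with h1 h2
    · exact lt_of_lt_of_le h1 hc
    · exact mono hu
    · change i - 1 < n; omega
  | app f ts ih => exact fun j => ih j (h j)

theorem Formula.Below.subst {A : Formula} {u : Term} (hu : u.Below 0) :
    ∀ {n c : ℕ}, A.Below (n + 1) → c ≤ n → (A.subst c u).Below n := by
  induction A with
  | eq s t => intro n c h hc; exact ⟨h.1.subst hu hc, h.2.subst hu hc⟩
  | neg A ih => intro n c h hc; exact ih (n := n) h hc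
  | imp A B ihA ihB => intro n c h hc; exact ⟨ihA h.1 hc, ihB h.2 hc⟩
  | all A ih =>
    intro n c h hc
    change (A.subst (c + 1) (u.lift 0)).Below (n + 1)
    rw [hu.lift_eq le_rfl]
    exact ih (n := n + 1) h (by omega)

theorem Formula.QuantifierFree.subst {A : Formula} (c : ℕ) (u : Term) (h : A.QuantifierFree) :
    (A.subst c u).QuantifierFree := by
  induction A with
  | eq s t => trivial
  | neg A ih => exact ih h
  | imp A B ihA ihB => exact ⟨ihA h.1, ihB h.2⟩
  | all A ih => exact h.elim

theorem numeral_below (n : ℕ) : (numeral n).Below 0 := by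
  induction n with
  | zero => intro j; exact j.elim0
  | succ n ih => intro j; fin_cases j; exact ih

@[simp] theorem numeral_lift (n c : ℕ) : (numeral n).lift c = numeral n :=
  (numeral_below n).lift_eq (Nat.zero_le c)

@[simp] theorem numeral_subst (n c : ℕ) (u : Term) : (numeral n).subst c u = numeral n :=
  (numeral_below n).subst_eq (Nat.zero_le c)

@[simp] theorem numeral_eval (n : ℕ) (v : ℕ → ℕ) : (numeral n).eval v = n := by
  induction n with
  | zero => rfl
  | succ n ih => change (numeral n).eval v + 1 = n + 1; rw [ih]

theorem Term.subst_subst_comm (t : Term) {u w : Term} (hu : u.Below 0) (hw : w.Below 0) (c : ℕ) :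
    (t.subst c u).subst c w = (t.subst (c + 1) w).subst c u := by
  induction t with
  | var i =>
    rcases Nat.lt_trichotomy i c with h | rfl | h
    · have h1 : i < c + 1 := by omega
      simp [Term.subst, h, h1]
    · simp [Term.subst, hu.subst_eq (Nat.zero_le _)]
    · have h1 : ¬ i < c := by omega
      have h2 : i ≠ c := by omega
      rcases Nat.lt_or_ge (c + 1) i with h3 | h3
      · have h4 : ¬ i < c + 1 := by omega
        have h5 : i ≠ c + 1 := by omega
        have h6 : ¬ i - 1 < c := by omega
        have h7 : i - 1 ≠ c := by omega
        simp [Term.subst, h1, h2, h4, h5, h6, h7]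
      · obtain rfl : i = c + 1 := by omega
        simp [Term.subst, hw.subst_eq (Nat.zero_le _)]
  | app f ts ih => simp [Term.subst, ih]

theorem Formula.subst_subst_comm (A : Formula) {u w : Term} (hu : u.Below 0) (hw : w.Below 0) :
    ∀ c : ℕ, (A.subst c u).subst c w = (A.subst (c + 1) w).subst c u := by
  induction A with
  | eq s t => intro c; simp [Formula.subst, Term.subst_subst_comm _ hu hw]
  | neg A ih => intro c; simp [Formula.subst, ih]
  | imp A B ihA ihB => intro c; simp [Formula.subst, ihA, ihB]
  | all A ih => intro c; simp [Formula.subst, hu.lift_eq le_rfl, hw.lift_eq le_rfl, ih]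

/-- `inst₂` fills in `y` before `x`, whereas instantiating `∀x∃y A` fills in `x` first. In this
order `A(m, ·)` is a formula in one variable, to which 1-consistency applies. -/
theorem Formula.inst₂_eq (A : Formula) (m n : ℕ) :
    A.inst₂ m n = (A.subst 1 (numeral m)).inst n :=
  A.subst_subst_comm (numeral_below n) (numeral_below m) 0

theorem Formula.Below.inst₂ {A : Formula} (h : A.Below 2) (m n : ℕ) : (A.inst₂ m n).Below 0 :=
  (h.subst (numeral_below n) (Nat.zero_le 1)).subst (numeral_below m) le_rfl

theorem Formula.QuantifierFree.inst₂ {A : Formula} (h : A.QuantifierFree) (m n : ℕ) :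
    (A.inst₂ m n).QuantifierFree :=
  (h.subst _ _).subst _ _

/-! ### Derivability -/

variable {S : Set Formula} {A B C : Formula} {Γ Δ : List Formula}

theorem provable_iff : Provable S A ↔ ∃ l, IsProof S (A :: l) :=
  ⟨fun ⟨_, l, h, _⟩ => ⟨l, h⟩, fun ⟨l, h⟩ => ⟨_, l, h, rfl⟩⟩

theorem IsProof.append {l l' : List Formula} (h : IsProof S l) (h' : IsProof S l') :
    IsProof S (l ++ l') := by
  induction l with
  | nil => exact h'
  | cons A l ih =>
    refine ⟨?_, ih h.2⟩
    rcases h.1 with h1 | h1 | ⟨B, hB, hBA⟩ | ⟨B, hB, hA⟩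
    · exact .inl h1
    · exact .inr (.inl h1)
    · exact .inr (.inr (.inl ⟨B, List.mem_append_left _ hB, List.mem_append_left _ hBA⟩))
    · exact .inr (.inr (.inr ⟨B, List.mem_append_left _ hB, hA⟩))

theorem LogicalAxiom.provable (h : LogicalAxiom A) : Provable S A :=
  provable_iff.2 ⟨[], .inl h, trivial⟩

theorem Provable.mp (h : Provable S (.imp A B)) (h' : Provable S A) : Provable S B := by
  obtain ⟨l, hl⟩ := provable_iff.1 h
  obtain ⟨l', hl'⟩ := provable_iff.1 h'
  refine provable_iff.2 ⟨(.imp A B :: l) ++ (A :: l'), ?_, hl.append hl'⟩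
  exact .inr (.inr (.inl ⟨A, by simp, by simp⟩))

theorem Provable.gen (h : Provable S A) : Provable S (.all A) := by
  obtain ⟨l, hl⟩ := provable_iff.1 h
  exact provable_iff.2 ⟨A :: l, .inr (.inr (.inr ⟨A, by simp, rfl⟩)), hl⟩

theorem Provable.spec (h : Provable S (.all A)) (t : Term) : Provable S (A.subst 0 t) :=
  (LogicalAxiom.spec A t).provable.mp h

theorem Provable.subst (h : Provable S A) (t : Term) : Provable S (A.subst 0 t) :=
  h.gen.spec t

/-- Derivability from a list of hypotheses, the variables of which are held fixed. -/
def Entails (S : Set Formula) : List Formula → Formula → Prop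
  | [], A => Provable S A
  | B :: Γ, A => Entails S Γ (.imp B A)

theorem Provable.entails (h : Provable S A) : Entails S Γ A := by
  induction Γ generalizing A with
  | nil => exact h
  | cons B Γ ih => exact ih ((LogicalAxiom.imp₁ A B).provable.mp h)

namespace Entails

/-- The deduction theorem holds by definition of `Entails`; what needs an induction is modus ponens
under hypotheses, by distributing each hypothesis over the implication. -/
theorem mp (h : Entails S Γ (.imp A B)) (h' : Entails S Γ A) : Entails S Γ B := by
  induction Γ generalizing A B with
  | nil => exact Provable.mp h h'
  | cons C Γ ih => exact ih (ih (LogicalAxiom.imp₂ C A B).provable.entails h) h'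

theorem refl (A : Formula) : Entails S Γ (.imp A A) :=
  mp (mp (LogicalAxiom.imp₂ A (.imp A A) A).provable.entails
    (LogicalAxiom.imp₁ A (.imp A A)).provable.entails) (LogicalAxiom.imp₁ A A).provable.entails

theorem hyp (h : A ∈ Γ) : Entails S Γ A := by
  induction Γ with
  | nil => simp at h
  | cons B Γ ih =>
    rcases List.mem_cons.1 h with rfl | h
    · exact refl (Γ := Γ) A
    · exact mp (Γ := Γ) (LogicalAxiom.imp₁ A B).provable.entails (ih h)

theorem mono (h : Entails S Γ A) (hΓ : Γ ⊆ Δ) : Entails S Δ A := by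
  induction Γ generalizing A with
  | nil => exact Provable.entails h
  | cons B Γ ih =>
    exact mp (ih h fun C hC => hΓ (List.mem_cons_of_mem _ hC)) (hyp (hΓ List.mem_cons_self))

theorem weaken (h : Entails S Γ A) : Entails S (B :: Γ) A :=
  h.mono (List.subset_cons_self _ _)

/-- Lifting the hypotheses frees the variable `0`, which is the usual eigenvariable condition. The
axioms `dist` and `vacuous` then move the quantifier past each hypothesis. -/
theorem gen (h : Entails S (Γ.map (Formula.lift 0)) A) : Entails S Γ (.all A) := by
  induction Γ generalizing A with
  | nil => exact Provable.gen h
  | cons B Γ ih =>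
    have h1 : Entails S Γ (.imp (.all (B.lift 0)) (.all A)) :=
      mp (LogicalAxiom.dist _ _).provable.entails (ih (A := .imp (B.lift 0) A) h)
    exact mp (Γ := B :: Γ) h1.weaken
      (mp (LogicalAxiom.vacuous B).provable.entails (hyp List.mem_cons_self))

theorem spec (h : Entails S Γ (.all A)) (t : Term) : Entails S Γ (A.subst 0 t) :=
  mp (LogicalAxiom.spec A t).provable.entails h

theorem absurd (h : Entails S Γ A) (h' : Entails S Γ (.neg A)) : Entails S Γ B :=
  mp (mp (LogicalAxiom.contra B A).provable.entails
    (mp (LogicalAxiom.imp₁ _ _).provable.entails h')) h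

/-- If `¬A` yields `A`, it yields the negation of the theorem `A ⊃ A`; contraposition turns this
into `(A ⊃ A) ⊃ A`. -/
theorem byContra (h : Entails S (.neg A :: Γ) A) : Entails S Γ A := by
  have h1 : Entails S (.neg A :: Γ) (.neg (.imp A A)) := h.absurd (hyp List.mem_cons_self)
  exact mp (mp (LogicalAxiom.contra A (.imp A A)).provable.entails h1) (refl A)

theorem neg_neg (h : Entails S Γ (.neg (.neg A))) : Entails S Γ A :=
  byContra ((hyp List.mem_cons_self).absurd h.weaken)

theorem neg_intro (h : Entails S (A :: Γ) (.neg A)) : Entails S Γ (.neg A) :=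
  byContra (mp (Γ := .neg (.neg A) :: Γ) (weaken (B := .neg (.neg A)) (Γ := Γ) h)
    (neg_neg (hyp List.mem_cons_self)))

theorem ex_intro (t : Term) (h : Entails S Γ (A.subst 0 t)) : Entails S Γ A.ex :=
  neg_intro (h.weaken.absurd (spec (A := .neg A) (hyp List.mem_cons_self) t))

theorem ex_elim (h : Entails S Γ A.ex)
    (h' : Entails S (A :: Γ.map (Formula.lift 0)) (C.lift 0)) : Entails S Γ C := by
  refine byContra (absurd (A := .all (.neg A)) (gen (neg_intro ?_)) h.weaken)
  refine absurd (A := C.lift 0) (h'.mono ?_) (hyp ?_)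
  · exact List.cons_subset_cons _ (List.subset_cons_self _ _)
  · exact List.mem_cons_of_mem _ List.mem_cons_self

theorem imp_ex_of_ex_imp (h : Entails S Γ (.ex (.imp (A.lift 0) B))) :
    Entails S Γ (.imp A (.ex B)) := by
  change Entails S (A :: Γ) (.ex B)
  refine ex_elim h.weaken ?_
  refine ex_intro (A := B.lift 1) (.var 0) ?_
  rw [B.subst_lift_succ 0]
  exact mp (hyp List.mem_cons_self) (hyp (by simp))

/-- Suppose there is no such witness. Then `A` holds, since otherwise `0` would be a vacuous
witness; so `∃y B` holds, and any `y` satisfying `B` is a witness after all. -/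
theorem ex_imp_of_imp_ex (h : Entails S Γ (.imp A (.ex B))) :
    Entails S Γ (.ex (.imp (A.lift 0) B)) := by
  refine byContra ?_
  have hA : Entails S (.neg (.ex (.imp (A.lift 0) B)) :: Γ) A := by
    refine byContra (absurd (A := .ex (.imp (A.lift 0) B)) (ex_intro .zero ?_) (hyp (by simp)))
    change Entails S (_ :: _ :: _) (.imp ((A.lift 0).subst 0 .zero) (B.subst 0 .zero))
    rw [A.subst_lift]
    exact absurd (A := A) (Γ := A :: .neg A :: _ :: Γ) (hyp (by simp)) (hyp (by simp))
  refine ex_elim (mp h.weaken hA) ?_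
  refine ex_intro (A := .imp ((A.lift 0).lift 1) (B.lift 1)) (.var 0) ?_
  change Entails S _ (.imp (((A.lift 0).lift 1).subst 0 (.var 0)) ((B.lift 1).subst 0 (.var 0)))
  rw [(A.lift 0).subst_lift_succ 0, B.subst_lift_succ 0]
  exact mp (LogicalAxiom.imp₁ _ _).provable.entails (hyp (by simp))

end Entails

theorem Inconsistent.provable (h : Inconsistent S) (A : Formula) : Provable S A :=
  let ⟨_, h1, h2⟩ := h
  Entails.absurd (Γ := []) h1 h2

theorem Provable.ex_intro (t : Term) (h : Provable S (A.subst 0 t)) : Provable S A.ex :=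
  Entails.ex_intro (Γ := []) t h

theorem Provable.neg_neg (h : Provable S A) : Provable S (.neg (.neg A)) :=
  Entails.neg_intro (Γ := []) (Entails.absurd (A := A) h.entails (Entails.hyp (by simp)))

theorem Term.subst_app₁ (f : PR 1) (a : Term) (c : ℕ) (u : Term) :
    (Term.app f ![a]).subst c u = .app f ![a.subst c u] := by
  simp only [Term.subst]; congr; funext j; fin_cases j; rfl

theorem Term.subst_app₂ (f : PR 2) (a b : Term) (c : ℕ) (u : Term) :
    (Term.app f ![a, b]).subst c u = .app f ![a.subst c u, b.subst c u] := by
  simp only [Term.subst]; congr; funext j; fin_cases j <;> rfl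

theorem Term.subst_app₃ (f : PR 3) (a b d : Term) (c : ℕ) (u : Term) :
    (Term.app f ![a, b, d]).subst c u = .app f ![a.subst c u, b.subst c u, d.subst c u] := by
  simp only [Term.subst]; congr; funext j; fin_cases j <;> rfl

/-! ### Equality -/

theorem Provable.eq_symm {s t : Term} (h : Provable S (.eq s t)) : Provable S (.eq t s) :=
  ((LogicalAxiom.eucl s t s).provable.mp h).mp (LogicalAxiom.refl s).provable

theorem Provable.eq_trans {s t u : Term} (h : Provable S (.eq s t)) (h' : Provable S (.eq t u)) :
    Provable S (.eq s u) :=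
  ((LogicalAxiom.eucl t s u).provable.mp h.eq_symm).mp h'

theorem Provable.app_congr {n : ℕ} (f : PR n) {ts ts' : Fin n → Term}
    (h : ∀ j, Provable S (.eq (ts j) (ts' j))) : Provable S (.eq (.app f ts) (.app f ts')) := by
  -- The congruence axiom changes one argument only, so the arguments are replaced one by one from
  -- the left.
  have key : ∀ k ≤ n, Provable S (.eq (.app f ts)
      (.app f fun j => if j.val < k then ts' j else ts j)) := by
    intro k
    induction k with
    | zero => intro _; simpa using (LogicalAxiom.refl (.app f ts)).provable
    | succ k ih =>
      intro hk
      refine (ih (by omega)).eq_trans ?_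
      have := (LogicalAxiom.congr f (fun j => if j.val < k then ts' j else ts j) ⟨k, hk⟩
        (ts ⟨k, hk⟩) (ts' ⟨k, hk⟩)).provable.mp (h ⟨k, hk⟩)
      convert this using 3
      · funext j
        by_cases hj : j = ⟨k, hk⟩
        · subst hj; simp
        · rw [Function.update_of_ne hj]
      · funext j
        by_cases hj : j = ⟨k, hk⟩
        · subst hj; simp
        · rw [Function.update_of_ne hj]
          have : j.val ≠ k := fun h => hj (Fin.ext h)
          have h2 : j.val < k + 1 ↔ j.val < k := by omega
          simp [h2]
  simpa using key n le_rfl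

/-! ### Simultaneous substitution of numerals -/

/-- Substitute numerals for the variables `0`, `1`, …. -/
def Term.numSubst (t : Term) (ws : List ℕ) : Term :=
  ws.foldl (fun t w => t.subst 0 (numeral w)) t

theorem Provable.numSubst {s t : Term} (h : Provable S (.eq s t)) (ws : List ℕ) :
    Provable S (.eq (s.numSubst ws) (t.numSubst ws)) := by
  induction ws generalizing s t with
  | nil => exact h
  | cons w ws ih => exact ih (h.subst (numeral w))

theorem Term.numSubst_numeral (n : ℕ) (ws : List ℕ) : (numeral n).numSubst ws = numeral n := by
  induction ws with
  | nil => rfl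
  | cons w ws ih => simpa [Term.numSubst] using ih

/-- Each `subst 0` lowers the remaining indices, so the entry at position `i` of the list meets the
variable that was originally `i`. -/
theorem Term.numSubst_var {ws : List ℕ} {i n : ℕ} (h : ws[i]? = some n) :
    (Term.var i).numSubst ws = numeral n := by
  induction ws generalizing i with
  | nil => simp at h
  | cons w ws ih =>
    cases i with
    | zero =>
      obtain rfl : w = n := by simpa using h
      exact Term.numSubst_numeral w ws
    | succ i => exact ih (by simpa using h)

theorem Term.numSubst_app {n : ℕ} (f : PR n) (ts : Fin n → Term) (ws : List ℕ) :
    (Term.app f ts).numSubst ws = .app f fun j => (ts j).numSubst ws := by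
  induction ws generalizing ts with
  | nil => rfl
  | cons w ws ih => exact ih _

/-! ### Evaluation of closed terms in arithmetical systems -/

namespace IsArithmeticalSystem

/-- Induction on the definition of `F`, with an inner induction on the recursion argument. Zero and
successor need no equation: applied to numerals they are numerals. -/
theorem eval_pr (hS : IsArithmeticalSystem S) {n : ℕ} (F : PR n) (v : Fin n → ℕ) :
    Provable S (.eq (.app F fun j => numeral (v j)) (numeral (F.eval v))) := by
  have var_ofFn : ∀ {n : ℕ} (v : Fin n → ℕ) (ws : List ℕ) (j : Fin n),
      (Term.var j).numSubst (List.ofFn v ++ ws) = numeral (v j) := fun v ws j =>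
    Term.numSubst_var (by simp [List.getElem?_append])
  induction F with
  | zero =>
    rw [show (fun j => numeral (v j)) = ![] from Subsingleton.elim _ _]
    exact (LogicalAxiom.refl _).provable
  | succ =>
    rw [show (fun j => numeral (v j)) = ![numeral (v 0)] by
      funext j; fin_cases j; rfl]
    exact (LogicalAxiom.refl _).provable
  | proj i =>
    have := (hS.recursion _ (.proj i)).numSubst (List.ofFn v ++ [])
    simp only [Term.numSubst_app, var_ofFn] at this
    exact this
  | comp f g ihf ihg =>
    have := (hS.recursion _ (.comp f g)).numSubst (List.ofFn v ++ [])
    simp only [Term.numSubst_app, var_ofFn] at this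
    exact (this.eq_trans (Provable.app_congr f fun k => ihg k v)).eq_trans (ihf _)
  | prec f g ihf ihg =>
    obtain ⟨y, v, rfl⟩ : ∃ y w, v = Matrix.vecCons y w :=
      ⟨Matrix.vecHead v, Matrix.vecTail v, (Matrix.cons_head_tail v).symm⟩
    have num_cons : ∀ {m : ℕ} (a : ℕ) (w : Fin m → ℕ),
        (fun j => numeral (Matrix.vecCons a w j)) =
          Matrix.vecCons (numeral a) fun j => numeral (w j) := by
      intro m a w; funext j; refine Fin.cases ?_ (fun j => ?_) j <;> rfl
    have subst_cons : ∀ {m : ℕ} (t : Term) (ts : Fin m → Term) (ws : List ℕ),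
        (fun j => (Matrix.vecCons t ts j).numSubst ws) =
          Matrix.vecCons (t.numSubst ws) fun j => (ts j).numSubst ws := by
      intro m t ts ws; funext j; refine Fin.cases ?_ (fun j => ?_) j <;> rfl
    rw [num_cons]
    induction y with
    | zero =>
      have := (hS.recursion _ (.prec_zero f g)).numSubst (List.ofFn v ++ [])
      simp only [Term.numSubst_app, subst_cons, var_ofFn] at this
      rw [show Term.zero.numSubst (List.ofFn v ++ []) = numeral 0 from
        Term.numSubst_numeral 0 _] at this
      exact this.eq_trans (ihf v)
    | succ y ih =>
      -- In `prec_succ` the recursion variable is `var n`, after the `n` parameters; hence `y` is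
      -- appended at the end of the list.
      have hy : (Term.var _).numSubst (List.ofFn v ++ [y]) = numeral y :=
        Term.numSubst_var (i := List.length (List.ofFn v)) (by simp)
      rw [List.length_ofFn] at hy
      have := (hS.recursion _ (.prec_succ f g)).numSubst (List.ofFn v ++ [y])
      simp only [Term.numSubst_app, subst_cons, var_ofFn, hy, Term.succ] at this
      rw [show (fun j : Fin 0 => Term.numSubst (![] j) (List.ofFn v ++ [y])) = ![] from
        Subsingleton.elim _ _] at this
      refine this.eq_trans ?_
      have h2 := ihg (Matrix.vecCons y (Matrix.vecCons
        ((PR.prec f g).eval (Matrix.vecCons y v)) v))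
      rw [num_cons, num_cons] at h2
      refine (Provable.app_congr g fun j => ?_).eq_trans h2
      refine Fin.cases ?_ (fun j => Fin.cases ?_ (fun j => ?_) j) j
      · exact (LogicalAxiom.refl _).provable
      · exact ih
      · exact (LogicalAxiom.refl _).provable

theorem eval_term (hS : IsArithmeticalSystem S) {t : Term} (h : t.Below 0) (v : ℕ → ℕ) :
    Provable S (.eq t (numeral (t.eval v))) := by
  induction t with
  | var i => exact absurd h (Nat.not_lt_zero i)
  | app f ts ih =>
    exact (Provable.app_congr f fun j => ih j (h j)).eq_trans (hS.eval_pr f _)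

theorem numeral_ne (hS : IsArithmeticalSystem S) {m n : ℕ} (h : m ≠ n) :
    Provable S (.neg (.eq (numeral m) (numeral n))) := by
  have hsucc : ∀ k : ℕ, Provable S (.neg (.eq (numeral (k + 1)) (numeral 0))) := fun k => by
      have := hS.succ_ne_zero.subst (numeral k)
      simp only [Formula.subst, Term.succ, Term.subst_app₁] at this
      rwa [show Term.zero.subst 0 (numeral k) = .zero from numeral_subst 0 0 _] at this
  have contrapose : ∀ {A B : Formula}, Provable S (.imp A B) → Provable S (.neg B) →
      Provable S (.neg A) := fun {A B} h1 h2 =>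
    Entails.neg_intro (Γ := []) (Entails.absurd (A := B)
      (Entails.mp h1.entails (Entails.hyp (by simp))) h2.entails)
  induction m generalizing n with
  | zero =>
    obtain ⟨k, rfl⟩ := Nat.exists_eq_succ_of_ne_zero h.symm
    refine contrapose ?_ (hsucc k)
    exact Entails.mp (Γ := [_]) (Entails.mp (LogicalAxiom.eucl _ _ _).provable.entails
      (Entails.hyp (by simp))) (LogicalAxiom.refl _).provable.entails
  | succ m ih =>
    cases n with
    | zero => exact hsucc m
    | succ n =>
      refine contrapose ?_ (ih (n := n) (by omega))
      have := (hS.succ_inj.subst (numeral n)).subst (numeral m)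
      simp only [Formula.subst, Term.succ, Term.subst_app₁] at this
      simp only [Term.subst, lt_irrefl, Nat.not_lt_zero, if_false, if_true, one_ne_zero,
        numeral_subst, Nat.sub_self] at this
      exact this

/-- An arithmetical system decides the closed quantifier-free formulas correctly. -/
theorem decides (hS : IsArithmeticalSystem S) {A : Formula} (hq : A.QuantifierFree)
    (hA : A.Below 0) (v : ℕ → ℕ) :
    (A.Holds v → Provable S A) ∧ (¬ A.Holds v → Provable S (.neg A)) := by
  induction A with
  | eq s t =>
    have h1 := hS.eval_term hA.1 v
    have h2 := hS.eval_term hA.2 v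
    constructor
    · intro h
      rw [show s.eval v = t.eval v from h] at h1
      exact h1.eq_trans h2.eq_symm
    · intro h
      -- From `s = t` and the values of both sides, the false equation between their numerals
      -- follows.
      refine Entails.neg_intro (Γ := []) (Entails.absurd
        (A := .eq (numeral (s.eval v)) (numeral (t.eval v))) ?_ (hS.numeral_ne h).entails)
      have h3 : Entails S [.eq s t] (.eq (numeral (s.eval v)) t) :=
        Entails.mp (Entails.mp (LogicalAxiom.eucl s _ t).provable.entails h1.entails)
          (Entails.hyp (by simp))
      refine Entails.mp (Entails.mp (LogicalAxiom.eucl t _ _).provable.entails ?_) h2.entails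
      exact Entails.mp (Entails.mp (LogicalAxiom.eucl _ t _).provable.entails h3)
        (LogicalAxiom.refl _).provable.entails
  | neg A ih =>
    have := ih hq hA
    exact ⟨this.2, fun h => (this.1 (not_not.1 h)).neg_neg⟩
  | imp A B ihA ihB =>
    have hA' := ihA hq.1 hA.1
    have hB' := ihB hq.2 hA.2
    constructor
    · intro h
      by_cases hh : A.Holds v
      · exact (LogicalAxiom.imp₁ B A).provable.mp (hB'.1 (h hh))
      · exact Entails.absurd (Γ := [A]) (A := A) (Entails.hyp (by simp)) (hA'.2 hh).entails
    · intro h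
      obtain ⟨h1, h2⟩ : A.Holds v ∧ ¬ B.Holds v := Classical.not_imp.1 h
      exact Entails.neg_intro (Γ := []) (Entails.absurd (A := B)
        (Entails.mp (Entails.hyp (by simp)) (hA'.1 h1).entails) (hB'.2 h2).entails)
  | all A ih => exact hq.elim

/-- Mere consistency gives soundness for closed quantifier-free formulas, because false ones are
refutable. -/
theorem holds_of_provable (hS : IsArithmeticalSystem S) (hc : ¬ Inconsistent S)
    (hq : A.QuantifierFree) (hA : A.Below 0) (h : Provable S A) (v : ℕ → ℕ) : A.Holds v := by
  by_contra hn
  exact hc ⟨A, h, (hS.decides hq hA v).2 hn⟩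

end IsArithmeticalSystem

/-! ### Estimates for codes -/

theorem lt_encode_list_of_mem {l : List ℕ} {x : ℕ} (h : x ∈ l) : x < Encodable.encode l := by
  induction l with
  | nil => simp at h
  | cons a l ih =>
    rw [Encodable.encode_list_cons]
    rcases List.mem_cons.1 h with rfl | h
    · exact Nat.lt_succ_of_le (Nat.left_le_pair _ _)
    · exact Nat.lt_succ_of_le ((ih h).le.trans (Nat.right_le_pair _ _))

theorem pair_le_pair {a b c d : ℕ} (h : a ≤ c) (h' : b ≤ d) : Nat.pair a b ≤ Nat.pair c d := by
  rcases h.lt_or_eq with h | rfl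
  · rcases h'.lt_or_eq with h' | rfl
    · exact ((Nat.pair_lt_pair_left b h).trans (Nat.pair_lt_pair_right c h')).le
    · exact (Nat.pair_lt_pair_left b h).le
  · rcases h'.lt_or_eq with h' | rfl
    · exact (Nat.pair_lt_pair_right a h').le
    · exact le_rfl

theorem lt_pair_of_pos {a b : ℕ} (h : 0 < a) : b < Nat.pair a b :=
  lt_of_lt_of_le (Nat.lt_add_of_pos_left h) (Nat.add_le_pair a b)

theorem encode_ofFn_mono {n : ℕ} {v w : Fin n → ℕ} (h : ∀ i, v i ≤ w i) :
    Encodable.encode (List.ofFn v) ≤ Encodable.encode (List.ofFn w) := by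
  induction n with
  | zero => simp
  | succ n ih =>
    rw [List.ofFn_succ, List.ofFn_succ, Encodable.encode_list_cons, Encodable.encode_list_cons]
    exact Nat.succ_le_succ (pair_le_pair (h 0) (ih fun i => h i.succ))

theorem encode_map_encode {α : Type*} [Encodable α] (l : List α) :
    Encodable.encode (l.map Encodable.encode) = Encodable.encode l := by
  induction l with
  | nil => rfl
  | cons a l ih => simp [Encodable.encode_list_cons, ih]

/-- The list of natural numbers with a given code. -/
def unlist (c : ℕ) : List ℕ := (Encodable.decode c).getD []

@[simp] theorem unlist_encode (l : List ℕ) : unlist (Encodable.encode l) = l := by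
  simp [unlist]

-- Every number codes a list of numbers, so the default value in `unlist` never comes into play.
@[simp] theorem encode_unlist (c : ℕ) : Encodable.encode (unlist c) = c := by
  have := Denumerable.encode_ofNat (α := List ℕ) c
  rw [Denumerable.ofNat_of_decode (b := unlist c)] at this
  · exact this
  · rw [Denumerable.decode_eq_ofNat, unlist, Denumerable.decode_eq_ofNat]; rfl

theorem primrec_unlist : Primrec unlist :=
  Primrec.option_getD.comp Primrec.decode (Primrec.const [])

/-! ### Injectivity of the Gödel numbering -/

/-- The arity is fixed by the type and need not be coded, except for the inner arity of a
composition, which its code records. -/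
theorem PR.code_injective {n : ℕ} : Function.Injective (PR.code (n := n)) := by
  intro F
  induction F with
  | zero => intro G h; cases G <;> simp_all [PR.code, Nat.pair_eq_pair]
  | succ => intro G h; cases G <;> simp_all [PR.code, Nat.pair_eq_pair]
  | proj i =>
    intro G h
    cases G <;> simp_all [PR.code, Nat.pair_eq_pair, Fin.ext_iff]
  | comp f g ihf ihg =>
    intro G h
    cases G with
    | comp f' g' =>
      simp only [PR.code, Nat.pair_eq_pair, true_and] at h
      obtain ⟨rfl, h1, h2⟩ := h
      have h3 := List.ofFn_injective (Encodable.encode_injective h2)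
      obtain rfl := ihf h1
      congr 1
      funext j
      exact ihg j (congrFun h3 j)
    | _ => simp [PR.code, Nat.pair_eq_pair] at h
  | prec f g ihf ihg =>
    intro G h
    cases G with
    | prec f' g' =>
      simp only [PR.code, Nat.pair_eq_pair, true_and] at h
      rw [ihf h.1, ihg h.2]
    | _ => simp [PR.code, Nat.pair_eq_pair] at h

theorem Term.code_injective : Function.Injective Term.code := by
  intro t
  induction t with
  | var i => intro u h; cases u <;> simp_all [Term.code, Nat.pair_eq_pair]
  | app f ts ih =>
    intro u h
    cases u with
    | var j => simp [Term.code, Nat.pair_eq_pair] at h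
    | app f' ts' =>
      simp only [Term.code, Nat.pair_eq_pair, true_and] at h
      obtain ⟨rfl, h1, h2⟩ := h
      have h3 := List.ofFn_injective (Encodable.encode_injective h2)
      obtain rfl := PR.code_injective h1
      congr 1
      funext j
      exact ih j (congrFun h3 j)

theorem Formula.code_injective : Function.Injective Formula.code := by
  intro A
  induction A with
  | eq s t =>
    intro B h
    cases B with
    | eq s' t' =>
      simp only [Formula.code, Nat.pair_eq_pair, true_and] at h
      rw [Term.code_injective h.1, Term.code_injective h.2]
    | _ => simp [Formula.code, Nat.pair_eq_pair] at h
  | neg A ih =>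
    intro B h
    cases B with
    | neg B => rw [ih (Nat.pair_eq_pair.1 h).2]
    | _ => simp [Formula.code, Nat.pair_eq_pair] at h
  | imp A A' ih ih' =>
    intro B h
    cases B with
    | imp B B' =>
      simp only [Formula.code, Nat.pair_eq_pair, true_and] at h
      rw [ih h.1, ih' h.2]
    | _ => simp [Formula.code, Nat.pair_eq_pair] at h
  | all A ih =>
    intro B h
    cases B with
    | all B => rw [ih (Nat.pair_eq_pair.1 h).2]
    | _ => simp [Formula.code, Nat.pair_eq_pair] at h

/-! ### The codes of function symbols, terms and formulas -/

theorem primrec_unpair_fst {α : Type*} [Primcodable α] {f : α → ℕ} (hf : Primrec f) :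
    Primrec fun a => (f a).unpair.1 := Primrec.fst.comp (Primrec.unpair.comp hf)

theorem primrec_unpair_snd {α : Type*} [Primcodable α] {f : α → ℕ} (hf : Primrec f) :
    Primrec fun a => (f a).unpair.2 := Primrec.snd.comp (Primrec.unpair.comp hf)

theorem primrecPred_eq {α β : Type*} [Primcodable α] [Primcodable β] {f g : α → β}
    (hf : Primrec f) (hg : Primrec g) : PrimrecPred fun a => f a = g a :=
  Primrec.eq.comp hf hg

/-- A predicate is primitive recursive if it holds at `b` exactly when `b` passes a primitive
recursive test and the predicate holds on a list of arguments of smaller measure. -/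
theorem primrecPred_of_rec {β : Type*} [Primcodable β] {p G : β → Prop} {m : β → ℕ}
    {l : β → List β} (hm : Primrec m) (hl : Primrec l) (hG : PrimrecPred G)
    (hlt : ∀ b, ∀ b' ∈ l b, m b' < m b) (h : ∀ b, p b ↔ G b ∧ ∀ b' ∈ l b, p b') :
    PrimrecPred p := by
  classical
  have hall : PrimrecPred fun q : β × List Bool => G q.1 ∧ ∀ r ∈ q.2, r = true :=
    (hG.comp Primrec.fst).and
      (PrimrecPred.comp (PrimrecPred.forall_mem_list
        (primrecPred_eq Primrec.id (Primrec.const true))) Primrec.snd)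
  -- Course-of-values recursion along `m`: the list `r` holds the truth values already computed on
  -- `l b`.
  refine Primrec.primrecPred (p := p) (Primrec.nat_omega_rec' _ hm hl
    (g := fun b r => some (decide (G b ∧ ∀ r' ∈ r, r' = true)))
    (Primrec.option_some.comp hall.decide) hlt ?_)
  intro b
  congr 2
  simp [h b]

/-- The arity `n` and the code `c` of the function symbols on which it depends whether `c` is the
code of a function symbol of arity `n`. -/
def prParts (b : ℕ × ℕ) : List (ℕ × ℕ) :=
  if b.2.unpair.1 = 3 then
    (b.2.unpair.2.unpair.1, b.2.unpair.2.unpair.2.unpair.1) ::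
      (unlist b.2.unpair.2.unpair.2.unpair.2).map fun c => (b.1, c)
  else if b.2.unpair.1 = 4 then
    [(b.1 - 1, b.2.unpair.2.unpair.1), (b.1 + 1, b.2.unpair.2.unpair.2)]
  else []

/-- A recursion of arity `n + 1` is built from symbols of arities `n` and `n + 2`, that is `b.1 - 1`
and `b.1 + 1`. The test `0 < b.1` makes the truncated subtraction exact. -/
theorem primrecPred_isPR : PrimrecPred fun b : ℕ × ℕ => ∃ F : PR b.1, F.code = b.2 := by
  have ht : Primrec fun b : ℕ × ℕ => b.2.unpair.1 := primrec_unpair_fst Primrec.snd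
  have hd : Primrec fun b : ℕ × ℕ => b.2.unpair.2 := primrec_unpair_snd Primrec.snd
  have hd1 := primrec_unpair_fst hd
  have hd2 := primrec_unpair_snd hd
  have hd21 := primrec_unpair_fst hd2
  have hd22 := primrec_unpair_snd hd2
  have htag : ∀ k : ℕ, PrimrecPred fun b : ℕ × ℕ => b.2.unpair.1 = k := fun k =>
    primrecPred_eq ht (Primrec.const k)
  refine primrecPred_of_rec (m := Prod.snd) (l := prParts)
    (G := fun b => (b.2.unpair.1 = 0 ∧ b.1 = 0 ∧ b.2.unpair.2 = 0) ∨
      (b.2.unpair.1 = 1 ∧ b.1 = 1 ∧ b.2.unpair.2 = 0) ∨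
      (b.2.unpair.1 = 2 ∧ b.2.unpair.2 < b.1) ∨
      (b.2.unpair.1 = 3 ∧
        (unlist b.2.unpair.2.unpair.2.unpair.2).length = b.2.unpair.2.unpair.1) ∨
      (b.2.unpair.1 = 4 ∧ 0 < b.1)) Primrec.snd ?_ ?_ ?_ ?_
  · refine Primrec.ite (htag 3) ?_ (Primrec.ite (htag 4) ?_ (Primrec.const []))
    · exact Primrec.list_cons.comp (Primrec.pair hd1 hd21)
        (Primrec.list_map (primrec_unlist.comp hd22)
          (Primrec.pair (Primrec.fst.comp Primrec.fst) Primrec.snd))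
    · exact Primrec.list_cons.comp
        (Primrec.pair (Primrec.nat_sub.comp Primrec.fst (Primrec.const 1)) hd1)
        (Primrec.list_cons.comp (Primrec.pair (Primrec.succ.comp Primrec.fst) hd2)
          (Primrec.const []))
  · refine .or ((htag 0).and (.and ?_ ?_)) (.or ((htag 1).and (.and ?_ ?_))
      (.or ((htag 2).and ?_) (.or ((htag 3).and ?_) ((htag 4).and ?_))))
    · exact primrecPred_eq Primrec.fst (Primrec.const 0)
    · exact primrecPred_eq hd (Primrec.const 0)
    · exact primrecPred_eq Primrec.fst (Primrec.const 1)
    · exact primrecPred_eq hd (Primrec.const 0)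
    · exact Primrec.nat_lt.comp hd Primrec.fst
    · exact primrecPred_eq (Primrec.list_length.comp (primrec_unlist.comp hd22)) hd1
    · exact Primrec.nat_lt.comp (Primrec.const 0) Primrec.fst
  · rintro ⟨n, c⟩ b' hb'
    obtain ⟨t, d, rfl⟩ : ∃ t d, c = Nat.pair t d := ⟨_, _, (Nat.pair_unpair c).symm⟩
    simp only [prParts, Nat.unpair_pair] at hb'
    split_ifs at hb' with h3 h4
    · subst h3
      have hlt : d < Nat.pair 3 d := lt_pair_of_pos (by norm_num)
      have hd2 := Nat.unpair_right_le d
      rcases List.mem_cons.1 hb' with rfl | hb'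
      · exact ((Nat.unpair_left_le _).trans hd2).trans_lt hlt
      · obtain ⟨x, hx, rfl⟩ := List.mem_map.1 hb'
        have := lt_encode_list_of_mem hx
        rw [encode_unlist] at this
        exact (this.le.trans ((Nat.unpair_right_le _).trans hd2)).trans_lt hlt
    · subst h4
      have hlt : d < Nat.pair 4 d := lt_pair_of_pos (by norm_num)
      simp only [List.mem_cons, List.not_mem_nil, or_false] at hb'
      rcases hb' with rfl | rfl
      · exact (Nat.unpair_left_le _).trans_lt hlt
      · exact (Nat.unpair_right_le _).trans_lt hlt
    · simp at hb'
  · rintro ⟨n, c⟩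
    constructor
    · rintro ⟨F, hF⟩
      change PR n at F
      change F.code = c at hF
      subst hF
      cases F with
      | zero => simp [PR.code, prParts]
      | succ => simp [PR.code, prParts]
      | proj i => simp [PR.code, prParts]
      | comp f g => simp [PR.code, prParts]
      | prec f g => simp [PR.code, prParts]
    · obtain ⟨t, d, rfl⟩ : ∃ t d, c = Nat.pair t d := ⟨_, _, (Nat.pair_unpair c).symm⟩
      simp only [prParts, Nat.unpair_pair]
      rintro ⟨⟨rfl, rfl, rfl⟩ | ⟨rfl, rfl, rfl⟩ | ⟨rfl, h⟩ | ⟨rfl, h⟩ | ⟨rfl, h⟩, hl⟩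
      · exact ⟨.zero, rfl⟩
      · exact ⟨.succ, rfl⟩
      · exact ⟨.proj ⟨d, h⟩, rfl⟩
      · simp only [if_true, List.mem_cons, List.mem_map, forall_eq_or_imp, forall_exists_index,
          and_imp, forall_apply_eq_imp_iff₂] at hl
        obtain ⟨⟨f, hf⟩, hg⟩ := hl
        generalize hgs : unlist d.unpair.2.unpair.2 = gs at h hg
        have hg' : ∀ j : Fin d.unpair.1, ∃ G : PR n, G.code = gs[j] := fun j =>
          hg _ (List.getElem_mem _)
        choose g hg' using hg'
        refine ⟨.comp f g, ?_⟩
        have : List.ofFn (fun j => (g j).code) = gs := by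
          refine List.ext_getElem (by simp [h]) fun i h1 h2 => ?_
          simp [hg']
        simp only [PR.code, this, hf]
        rw [← hgs, encode_unlist, Nat.pair_unpair, Nat.pair_unpair]
      · obtain ⟨n, rfl⟩ := Nat.exists_eq_succ_of_ne_zero h.ne'
        simp only [Nat.reduceEqDiff, if_false, if_true, List.mem_cons,
          List.not_mem_nil, or_false, forall_eq_or_imp, forall_eq] at hl
        obtain ⟨⟨f, hf⟩, ⟨g, hg⟩⟩ := hl
        refine ⟨.prec f g, ?_⟩
        simp only [PR.code]
        rw [hf, hg, Nat.pair_unpair]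

theorem primrecPred_isTerm : PrimrecPred fun c : ℕ => ∃ t : Term, t.code = c := by
  have ht : Primrec fun c : ℕ => c.unpair.1 := primrec_unpair_fst Primrec.id
  have hd : Primrec fun c : ℕ => c.unpair.2 := primrec_unpair_snd Primrec.id
  have hd1 := primrec_unpair_fst hd
  have hd2 := primrec_unpair_snd hd
  have hd21 := primrec_unpair_fst hd2
  have hd22 := primrec_unpair_snd hd2
  have htag : ∀ k : ℕ, PrimrecPred fun c : ℕ => c.unpair.1 = k := fun k =>
    primrecPred_eq ht (Primrec.const k)
  refine primrecPred_of_rec (m := id)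
    (l := fun c => if c.unpair.1 = 1 then unlist c.unpair.2.unpair.2.unpair.2 else [])
    (G := fun c => c.unpair.1 = 0 ∨ (c.unpair.1 = 1 ∧
      (unlist c.unpair.2.unpair.2.unpair.2).length = c.unpair.2.unpair.1 ∧
      ∃ F : PR c.unpair.2.unpair.1, F.code = c.unpair.2.unpair.2.unpair.1))
    Primrec.id ?_ ?_ ?_ ?_
  · exact Primrec.ite (htag 1) (primrec_unlist.comp hd22) (Primrec.const [])
  · refine .or (htag 0) ((htag 1).and (.and ?_ ?_))
    · exact primrecPred_eq (Primrec.list_length.comp (primrec_unlist.comp hd22)) hd1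
    · exact primrecPred_isPR.comp (Primrec.pair hd1 hd21)
  · intro c b hb
    obtain ⟨t, d, rfl⟩ : ∃ t d, c = Nat.pair t d := ⟨_, _, (Nat.pair_unpair c).symm⟩
    simp only [Nat.unpair_pair] at hb
    split_ifs at hb with h1
    · subst h1
      have := lt_encode_list_of_mem hb
      rw [encode_unlist] at this
      exact (this.le.trans ((Nat.unpair_right_le _).trans (Nat.unpair_right_le _))).trans_lt
        (lt_pair_of_pos (by norm_num))
    · simp at hb
  · intro c
    constructor
    · rintro ⟨t, rfl⟩
      cases t with
      | var i => simp [Term.code]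
      | @app n f ts =>
        -- The arity occurs in the type of `F`; with it generalized, the decoded arity can be
        -- replaced by `n`.
        have hf : ∀ m k, m = n → k = f.code → ∃ F : PR m, F.code = k := by
          rintro _ _ rfl rfl
          exact ⟨f, rfl⟩
        exact ⟨.inr ⟨by simp [Term.code], by simp [Term.code],
          hf _ _ (by simp [Term.code]) (by simp [Term.code])⟩, by simp [Term.code]⟩
    · obtain ⟨t, d, rfl⟩ : ∃ t d, c = Nat.pair t d := ⟨_, _, (Nat.pair_unpair c).symm⟩
      rw [Nat.unpair_pair]
      rintro ⟨rfl | ⟨rfl, h, hF⟩, hl⟩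
      · exact ⟨.var d, rfl⟩
      · dsimp only at h hF
        obtain ⟨F, hF⟩ := hF
        simp only [if_true] at hl
        generalize hts : unlist d.unpair.2.unpair.2 = ts at h hl
        have hts' : ∀ j : Fin d.unpair.1, ∃ t : Term, t.code = ts[j] := fun j =>
          hl _ (List.getElem_mem _)
        choose us hus using hts'
        refine ⟨.app F us, ?_⟩
        have : List.ofFn (fun j => (us j).code) = ts := by
          refine List.ext_getElem (by simp [h]) fun i h1 h2 => ?_
          simp [hus]
        simp only [Term.code, this, hF]
        rw [← hts, encode_unlist, Nat.pair_unpair, Nat.pair_unpair]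

/-- The codes of the immediate subformulas of the formula with code `c`. -/
def subformulaCodes (c : ℕ) : List ℕ :=
  if c.unpair.1 = 1 ∨ c.unpair.1 = 3 then [c.unpair.2]
  else if c.unpair.1 = 2 then [c.unpair.2.unpair.1, c.unpair.2.unpair.2] else []

theorem primrec_subformulaCodes : Primrec subformulaCodes := by
  have ht : Primrec fun c : ℕ => c.unpair.1 := primrec_unpair_fst Primrec.id
  have hd : Primrec fun c : ℕ => c.unpair.2 := primrec_unpair_snd Primrec.id
  have htag : ∀ k : ℕ, PrimrecPred fun c : ℕ => c.unpair.1 = k := fun k =>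
    primrecPred_eq ht (Primrec.const k)
  exact Primrec.ite ((htag 1).or (htag 3)) (Primrec.list_cons.comp hd (Primrec.const []))
    (Primrec.ite (htag 2) (Primrec.list_cons.comp (primrec_unpair_fst hd)
      (Primrec.list_cons.comp (primrec_unpair_snd hd) (Primrec.const []))) (Primrec.const []))

theorem lt_of_mem_subformulaCodes {b c : ℕ} (h : b ∈ subformulaCodes c) : b < c := by
  obtain ⟨t, d, rfl⟩ : ∃ t d, c = Nat.pair t d := ⟨_, _, (Nat.pair_unpair c).symm⟩
  simp only [subformulaCodes, Nat.unpair_pair] at h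
  split_ifs at h with h1 h2
  · obtain rfl : b = d := by simpa using h
    exact lt_pair_of_pos (by omega)
  · have hlt : d < Nat.pair t d := lt_pair_of_pos (by omega)
    simp only [List.mem_cons, List.not_mem_nil, or_false] at h
    rcases h with rfl | rfl
    · exact (Nat.unpair_left_le _).trans_lt hlt
    · exact (Nat.unpair_right_le _).trans_lt hlt
  · simp at h

theorem primrecPred_isFormula : PrimrecPred fun c : ℕ => ∃ A : Formula, A.code = c := by
  have ht : Primrec fun c : ℕ => c.unpair.1 := primrec_unpair_fst Primrec.id
  have hd : Primrec fun c : ℕ => c.unpair.2 := primrec_unpair_snd Primrec.id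
  have htag : ∀ k : ℕ, PrimrecPred fun c : ℕ => c.unpair.1 = k := fun k =>
    primrecPred_eq ht (Primrec.const k)
  refine primrecPred_of_rec (m := id) (l := subformulaCodes)
    (G := fun c => (c.unpair.1 = 0 ∧ (∃ t : Term, t.code = c.unpair.2.unpair.1) ∧
      ∃ t : Term, t.code = c.unpair.2.unpair.2) ∨ c.unpair.1 = 1 ∨ c.unpair.1 = 2 ∨
      c.unpair.1 = 3) Primrec.id primrec_subformulaCodes ?_
      (fun c b h => lt_of_mem_subformulaCodes h) ?_
  · exact .or ((htag 0).and ((primrecPred_isTerm.comp (primrec_unpair_fst hd)).and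
      (primrecPred_isTerm.comp (primrec_unpair_snd hd))))
      ((htag 1).or ((htag 2).or (htag 3)))
  · intro c
    constructor
    · rintro ⟨A, rfl⟩
      cases A <;> simp [Formula.code, subformulaCodes]
    · obtain ⟨t, d, rfl⟩ : ∃ t d, c = Nat.pair t d := ⟨_, _, (Nat.pair_unpair c).symm⟩
      simp only [Nat.unpair_pair, subformulaCodes]
      rintro ⟨⟨rfl, ⟨s, hs⟩, ⟨t, ht⟩⟩ | rfl | rfl | rfl, hl⟩
      · exact ⟨.eq s t, by rw [Formula.code, hs, ht, Nat.pair_unpair]⟩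
      · obtain ⟨A, hA⟩ := hl d (by simp)
        exact ⟨.neg A, by rw [Formula.code, hA]⟩
      · obtain ⟨A, hA⟩ := hl d.unpair.1 (by simp)
        obtain ⟨B, hB⟩ := hl d.unpair.2 (by simp)
        exact ⟨.imp A B, by rw [Formula.code, hA, hB, Nat.pair_unpair]⟩
      · obtain ⟨A, hA⟩ := hl d (by simp)
        exact ⟨.all A, by rw [Formula.code, hA]⟩

open Classical in
/-- A type with an injective numbering, the range of which is primitive recursive. -/
@[reducible] noncomputable def primcodableOfCode {α : Type*} (code : α → ℕ)
    (inj : Function.Injective code) (hp : PrimrecPred fun c => ∃ a, code a = c) :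
    Primcodable α where
  encode := code
  decode c := if h : ∃ a, code a = c then some h.choose else none
  encodek a := by
    have h : ∃ b, code b = code a := ⟨a, rfl⟩
    rw [dif_pos h, inj h.choose_spec]
  prim := by
    refine Primrec.nat_iff.1 ((Primrec.ite hp Primrec.succ (Primrec.const 0)).of_eq fun c => ?_)
    by_cases h : ∃ a, code a = c
    · rw [if_pos h, dif_pos h]
      exact congrArg Nat.succ h.choose_spec.symm
    · rw [if_neg h, dif_neg h]
      rfl

/-- With these instances `encode` is `code` by definition, so `Primrec` for terms and formulas means
primitive recursive in Gödel numbers. -/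
noncomputable instance : Primcodable Term :=
  primcodableOfCode Term.code Term.code_injective primrecPred_isTerm

noncomputable instance : Primcodable Formula :=
  primcodableOfCode Formula.code Formula.code_injective primrecPred_isFormula

theorem codeSeq_eq_encode (l : List Formula) : codeSeq l = Encodable.encode l :=
  encode_map_encode l

/-! ### Primitive recursive operations on terms -/

theorem Term.primrec_code : Primrec Term.code := Primrec.encode

/-- The term with code `c`. -/
noncomputable def Term.ofCode (c : ℕ) : Term := (Encodable.decode c).getD (.var 0)

@[simp] theorem Term.ofCode_code (t : Term) : Term.ofCode t.code = t := by
  have : Encodable.decode t.code = some t := Encodable.encodek t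
  simp [Term.ofCode, this]

theorem Term.primrec_ofCode : Primrec Term.ofCode :=
  Primrec.option_getD.comp Primrec.decode (Primrec.const _)

/-- The arguments of the outermost function symbol of a term. -/
noncomputable def Term.args (t : Term) : List Term :=
  if t.code.unpair.1 = 1 then (unlist t.code.unpair.2.unpair.2.unpair.2).map Term.ofCode else []

@[simp] theorem Term.args_app {n : ℕ} (f : PR n) (ts : Fin n → Term) :
    (Term.app f ts).args = List.ofFn ts := by
  simp [Term.args, Term.code, List.map_ofFn, Function.comp_def]

theorem Term.primrec_args : Primrec Term.args :=
  Primrec.ite (primrecPred_eq (primrec_unpair_fst Term.primrec_code) (Primrec.const 1))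
    (Primrec.list_map (primrec_unlist.comp (primrec_unpair_snd (primrec_unpair_snd
      (primrec_unpair_snd Term.primrec_code)))) (Term.primrec_ofCode.comp Primrec.snd))
    (Primrec.const [])

theorem Term.code_lt_of_mem_args {s t : Term} (h : s ∈ t.args) : s.code < t.code := by
  cases t with
  | var i => simp [Term.args, Term.code] at h
  | app f ts =>
    rw [Term.args_app, List.mem_ofFn] at h
    obtain ⟨j, rfl⟩ := h
    have := lt_encode_list_of_mem (l := List.ofFn fun j => (ts j).code) (x := (ts j).code)
      (List.mem_ofFn.2 ⟨j, rfl⟩)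
    exact this.trans_le ((Nat.right_le_pair _ _).trans ((Nat.right_le_pair _ _).trans
      (Nat.right_le_pair _ _)))

/-- The term with the same outermost function symbol as `t` and the arguments `l`. -/
noncomputable def Term.rebuild (t : Term) (l : List Term) : Term :=
  .ofCode (Nat.pair 1 (Nat.pair t.code.unpair.2.unpair.1
    (Nat.pair t.code.unpair.2.unpair.2.unpair.1 (Encodable.encode l))))

-- `args` and `rebuild` take a term apart and put it together through a plain list, which keeps the
-- dependent arity out of the recursions on terms.
@[simp] theorem Term.rebuild_app {n : ℕ} (f : PR n) (ts us : Fin n → Term) :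
    (Term.app f ts).rebuild (List.ofFn us) = .app f us := by
  rw [← Term.ofCode_code (.app f us), Term.rebuild, ← encode_map_encode, List.map_ofFn]
  simp only [Term.code, Nat.unpair_pair]
  rfl

theorem Term.primrec_rebuild : Primrec₂ Term.rebuild := by
  have hd : Primrec fun q : Term × List Term => q.1.code.unpair.2 :=
    primrec_unpair_snd (Term.primrec_code.comp Primrec.fst)
  exact Term.primrec_ofCode.comp (Primrec₂.natPair.comp (Primrec.const 1)
    (Primrec₂.natPair.comp (primrec_unpair_fst hd) (Primrec₂.natPair.comp
      (primrec_unpair_fst (primrec_unpair_snd hd)) (Primrec.encode.comp Primrec.snd))))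

theorem Term.primrec_var : Primrec Term.var :=
  Primrec.encode_iff.1 (Primrec₂.natPair.comp (Primrec.const 0) Primrec.id)

/-- Primitive recursion on terms. -/
theorem Term.primrec_rec {α σ : Type*} [Primcodable α] [Primcodable σ] {f : α → Term → σ}
    {g : α → ℕ → σ} {h : α → Term × List σ → σ} (hg : Primrec₂ g) (hh : Primrec₂ h)
    (hvar : ∀ a i, f a (.var i) = g a i)
    (happ : ∀ (a : α) {n : ℕ} (F : PR n) (ts : Fin n → Term),
      f a (.app F ts) = h a (.app F ts, List.ofFn fun j => f a (ts j))) : Primrec₂ f := by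
  have hc : Primrec fun q : α × Term × List σ => q.2.1.code :=
    Term.primrec_code.comp (Primrec.fst.comp Primrec.snd)
  refine Primrec.nat_omega_rec f (m := fun _ t => t.code) (l := fun _ t => t.args)
    (g := fun a q => some (if q.1.code.unpair.1 = 0 then g a q.1.code.unpair.2 else h a q))
    (Term.primrec_code.comp Primrec.snd) (Term.primrec_args.comp Primrec.snd) ?_
    (fun _ _ _ => Term.code_lt_of_mem_args) ?_
  · exact Primrec.option_some.comp (Primrec.ite
      (primrecPred_eq (primrec_unpair_fst hc) (Primrec.const 0))
      (hg.comp Primrec.fst (primrec_unpair_snd hc)) (hh.comp Primrec.fst Primrec.snd))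
  · intro a t
    cases t with
    | var i => simp [Term.code, hvar]
    | app F ts =>
      rw [if_neg (by simp [Term.code]), happ, Term.args_app, List.map_ofFn]
      rfl

theorem Term.primrec_lift : Primrec₂ Term.lift := by
  refine Term.primrec_rec (g := fun c i => if i < c then .var i else .var (i + 1))
    (h := fun _ q => q.1.rebuild q.2) ?_ ?_ (fun _ _ => rfl) fun c n F ts => ?_
  · exact Primrec.ite (Primrec.nat_lt.comp Primrec.snd Primrec.fst)
      (Term.primrec_var.comp Primrec.snd) (Term.primrec_var.comp (Primrec.succ.comp Primrec.snd))
  · exact Term.primrec_rebuild.comp (Primrec.fst.comp Primrec.snd) (Primrec.snd.comp Primrec.snd)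
  · exact (Term.rebuild_app F ts _).symm

theorem Term.primrec_subst : Primrec₂ fun (p : ℕ × Term) (t : Term) => t.subst p.1 p.2 := by
  refine Term.primrec_rec
    (g := fun p i => if i < p.1 then .var i else if i = p.1 then p.2 else .var (i - 1))
    (h := fun _ q => q.1.rebuild q.2) ?_ ?_ (fun _ _ => rfl) fun c n F ts => ?_
  · exact Primrec.ite (Primrec.nat_lt.comp Primrec.snd (Primrec.fst.comp Primrec.fst))
      (Term.primrec_var.comp Primrec.snd)
      (Primrec.ite (primrecPred_eq Primrec.snd (Primrec.fst.comp Primrec.fst))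
        (Primrec.snd.comp Primrec.fst)
        (Term.primrec_var.comp (Primrec.nat_sub.comp Primrec.snd (Primrec.const 1))))
  · exact Term.primrec_rebuild.comp (Primrec.fst.comp Primrec.snd) (Primrec.snd.comp Primrec.snd)
  · exact (Term.rebuild_app F ts _).symm

theorem Term.primrecRel_below : PrimrecRel Term.Below := by
  have hc : Primrec fun q : ℕ × Term => q.2.code := Term.primrec_code.comp Primrec.snd
  refine (primrecPred_of_rec (β := ℕ × Term) (p := fun q => q.2.Below q.1)
    (m := fun q => q.2.code) (l := fun q => q.2.args.map fun t => (q.1, t))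
    (G := fun q => q.2.code.unpair.1 = 1 ∨ q.2.code.unpair.2 < q.1) hc ?_ ?_ ?_ ?_)
  · exact Primrec.list_map (Term.primrec_args.comp Primrec.snd)
      (Primrec.pair (Primrec.fst.comp Primrec.fst) Primrec.snd)
  · exact .or (primrecPred_eq (primrec_unpair_fst hc) (Primrec.const 1))
      (Primrec.nat_lt.comp (primrec_unpair_snd hc) Primrec.fst)
  · rintro ⟨n, t⟩ b hb
    obtain ⟨s, hs, rfl⟩ := List.mem_map.1 hb
    exact Term.code_lt_of_mem_args hs
  · rintro ⟨n, t⟩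
    cases t with
    | var i => simp [Term.args, Term.code, Term.Below]
    | app f ts => simp [Term.code, Term.Below]

/-! ### Primitive recursive operations on formulas -/

theorem Formula.primrec_code : Primrec Formula.code := Primrec.encode

/-- The formula with code `c`. -/
noncomputable def Formula.ofCode (c : ℕ) : Formula :=
  (Encodable.decode c).getD (.eq (.var 0) (.var 0))

@[simp] theorem Formula.ofCode_code (A : Formula) : Formula.ofCode A.code = A := by
  have : Encodable.decode A.code = some A := Encodable.encodek A
  simp [Formula.ofCode, this]

theorem Formula.primrec_ofCode : Primrec Formula.ofCode :=
  Primrec.option_getD.comp Primrec.decode (Primrec.const _)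

theorem Formula.primrec_eq : Primrec₂ Formula.eq :=
  Primrec.encode_iff.1 (Primrec₂.natPair.comp (Primrec.const 0) (Primrec₂.natPair.comp
    (Term.primrec_code.comp Primrec.fst) (Term.primrec_code.comp Primrec.snd)))

theorem Formula.primrec_neg : Primrec Formula.neg :=
  Primrec.encode_iff.1 (Primrec₂.natPair.comp (Primrec.const 1) Formula.primrec_code)

theorem Formula.primrec_imp : Primrec₂ Formula.imp :=
  Primrec.encode_iff.1 (Primrec₂.natPair.comp (Primrec.const 2) (Primrec₂.natPair.comp
    (Formula.primrec_code.comp Primrec.fst) (Formula.primrec_code.comp Primrec.snd)))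

theorem Formula.primrec_all : Primrec Formula.all :=
  Primrec.encode_iff.1 (Primrec₂.natPair.comp (Primrec.const 3) Formula.primrec_code)

/-- The immediate subformulas of a formula. -/
noncomputable def Formula.subs (A : Formula) : List Formula :=
  (subformulaCodes A.code).map Formula.ofCode

@[simp] theorem Formula.subs_eq (s t : Term) : (Formula.eq s t).subs = [] := by
  simp [Formula.subs, subformulaCodes, Formula.code]

@[simp] theorem Formula.subs_neg (A : Formula) : A.neg.subs = [A] := by
  simp [Formula.subs, subformulaCodes, Formula.code]

@[simp] theorem Formula.subs_imp (A B : Formula) : (A.imp B).subs = [A, B] := by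
  simp [Formula.subs, subformulaCodes, Formula.code]

@[simp] theorem Formula.subs_all (A : Formula) : A.all.subs = [A] := by
  simp [Formula.subs, subformulaCodes, Formula.code]

theorem Formula.primrec_subs : Primrec Formula.subs :=
  Primrec.list_map (primrec_subformulaCodes.comp Formula.primrec_code)
    (Formula.primrec_ofCode.comp Primrec.snd)

theorem Formula.code_lt_of_mem_subs {A B : Formula} (h : B ∈ A.subs) : B.code < A.code := by
  have key : ∀ C ∈ A.subs, C.code ∈ subformulaCodes A.code := by
    cases A <;> simp [subformulaCodes, Formula.code]
  exact lt_of_mem_subformulaCodes (key B h)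

/-- Primitive recursion on formulas, with a parameter that may change under quantifiers. -/
theorem Formula.primrec_rec {α σ : Type*} [Primcodable α] [Primcodable σ]
    {f : α → Formula → σ} {u : α → α} {g₀ : α → Term × Term → σ} {g₁ : σ → σ} {g₂ : σ → σ → σ}
    {g₃ : σ → σ} (hu : Primrec u) (h₀ : Primrec₂ g₀) (h₁ : Primrec g₁) (h₂ : Primrec₂ g₂)
    (h₃ : Primrec g₃) (heq : ∀ a s t, f a (.eq s t) = g₀ a (s, t))
    (hneg : ∀ a A, f a (.neg A) = g₁ (f a A))
    (himp : ∀ a A B, f a (.imp A B) = g₂ (f a A) (f a B))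
    (hall : ∀ a A, f a (.all A) = g₃ (f (u a) A)) : Primrec₂ f := by
  have hc : Primrec fun q : α × Formula => q.2.code := Formula.primrec_code.comp Primrec.snd
  have hc' : Primrec fun q : (α × Formula) × List σ => q.1.2.code := hc.comp Primrec.fst
  have htag : ∀ k, PrimrecPred fun q : (α × Formula) × List σ => q.1.2.code.unpair.1 = k :=
    fun k => primrecPred_eq (primrec_unpair_fst hc') (Primrec.const k)
  have hd := primrec_unpair_snd hc'
  have hhead : Primrec fun q : (α × Formula) × List σ => q.2.head? :=
    Primrec.list_head?.comp Primrec.snd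
  refine Primrec₂.uncurry.1 (Primrec.nat_omega_rec' (Function.uncurry f)
    (m := fun q => q.2.code)
    (l := fun q => q.2.subs.map fun A => (if q.2.code.unpair.1 = 3 then u q.1 else q.1, A))
    (g := fun q r =>
      if q.2.code.unpair.1 = 0 then
        some (g₀ q.1 (.ofCode q.2.code.unpair.2.unpair.1, .ofCode q.2.code.unpair.2.unpair.2))
      else if q.2.code.unpair.1 = 1 then r.head?.map g₁
      else if q.2.code.unpair.1 = 2 then r.head?.bind fun x => r.tail.head?.map (g₂ x)
      else r.head?.map g₃) hc ?_ ?_ ?_ ?_)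
  · refine Primrec.list_map (Formula.primrec_subs.comp Primrec.snd)
      (Primrec.pair (Primrec.ite ?_ ?_ ?_) Primrec.snd)
    · exact primrecPred_eq (primrec_unpair_fst (hc.comp Primrec.fst)) (Primrec.const 3)
    · exact hu.comp (Primrec.fst.comp Primrec.fst)
    · exact Primrec.fst.comp Primrec.fst
  · refine Primrec.ite (htag 0) ?_ (Primrec.ite (htag 1) ?_ (Primrec.ite (htag 2) ?_ ?_))
    · exact Primrec.option_some.comp (h₀.comp (Primrec.fst.comp Primrec.fst)
        (Primrec.pair (Term.primrec_ofCode.comp (primrec_unpair_fst hd))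
          (Term.primrec_ofCode.comp (primrec_unpair_snd hd))))
    · exact Primrec.option_map hhead (h₁.comp Primrec.snd)
    · exact Primrec.option_bind hhead (Primrec.option_map
        (Primrec.list_head?.comp (Primrec.list_tail.comp (Primrec.snd.comp Primrec.fst)))
        (h₂.comp (Primrec.snd.comp Primrec.fst) Primrec.snd))
    · exact Primrec.option_map hhead (h₃.comp Primrec.snd)
  · rintro ⟨a, A⟩ b hb
    obtain ⟨B, hB, rfl⟩ := List.mem_map.1 hb
    exact Formula.code_lt_of_mem_subs hB
  · rintro ⟨a, A⟩
    cases A with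
    | eq s t => simp [Formula.code, heq]
    | neg A => simp [Formula.code, hneg]
    | imp A B => simp [Formula.code, himp]
    | all A => simp [Formula.code, hall]

theorem Formula.primrec_lift : Primrec₂ Formula.lift := by
  refine Formula.primrec_rec (u := fun c => c + 1)
    (g₀ := fun c q => .eq (q.1.lift c) (q.2.lift c)) Primrec.succ ?_ Formula.primrec_neg
    Formula.primrec_imp Formula.primrec_all (fun _ _ _ => rfl) (fun _ _ => rfl)
    (fun _ _ _ => rfl) (fun _ _ => rfl)
  exact Formula.primrec_eq.comp
    (Term.primrec_lift.comp Primrec.fst (Primrec.fst.comp Primrec.snd))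
    (Term.primrec_lift.comp Primrec.fst (Primrec.snd.comp Primrec.snd))

theorem Formula.primrec_subst :
    Primrec₂ fun (p : ℕ × Term) (A : Formula) => A.subst p.1 p.2 := by
  refine Formula.primrec_rec (u := fun p => (p.1 + 1, p.2.lift 0))
    (g₀ := fun p q => .eq (q.1.subst p.1 p.2) (q.2.subst p.1 p.2)) ?_ ?_ Formula.primrec_neg
    Formula.primrec_imp Formula.primrec_all (fun _ _ _ => rfl) (fun _ _ => rfl)
    (fun _ _ _ => rfl) (fun _ _ => rfl)
  · exact Primrec.pair (Primrec.succ.comp Primrec.fst)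
      (Term.primrec_lift.comp (Primrec.const 0) Primrec.snd)
  · exact Formula.primrec_eq.comp
      (Term.primrec_subst.comp Primrec.fst (Primrec.fst.comp Primrec.snd))
      (Term.primrec_subst.comp Primrec.fst (Primrec.snd.comp Primrec.snd))

theorem Formula.primrecRel_below : PrimrecRel fun (n : ℕ) (A : Formula) => A.Below n := by
  classical
  refine Primrec₂.primrecRel (Formula.primrec_rec (u := fun n => n + 1)
    (f := fun n A => decide (A.Below n))
    (g₀ := fun n q => decide (q.1.Below n ∧ q.2.Below n)) (g₁ := id) (g₂ := and) (g₃ := id)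
    Primrec.succ ?_ Primrec.id Primrec.and Primrec.id (fun _ _ _ => decide_eq_decide.2 Iff.rfl)
    (fun _ _ => decide_eq_decide.2 Iff.rfl)
    (fun _ _ _ => (decide_eq_decide.2 Iff.rfl).trans (Bool.decide_and _ _))
    (fun _ _ => decide_eq_decide.2 Iff.rfl))
  exact (PrimrecPred.and
    (Term.primrecRel_below.comp Primrec.fst (Primrec.fst.comp Primrec.snd))
    (Term.primrecRel_below.comp Primrec.fst (Primrec.snd.comp Primrec.snd))).decide

theorem Formula.primrecPred_quantifierFree : PrimrecPred Formula.QuantifierFree := by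
  classical
  have : Primrec₂ fun (_ : Unit) (A : Formula) => decide A.QuantifierFree :=
    Formula.primrec_rec (u := id) (g₀ := fun _ _ => true) (g₁ := id) (g₂ := and)
      (g₃ := fun _ => false) Primrec.id (Primrec.const true) Primrec.id Primrec.and
      (Primrec.const false) (fun _ _ _ => decide_eq_true trivial)
      (fun _ _ => decide_eq_decide.2 Iff.rfl)
      (fun _ _ _ => (decide_eq_decide.2 Iff.rfl).trans (Bool.decide_and _ _))
      (fun _ _ => decide_eq_false id)
  exact Primrec.primrecPred (this.comp (Primrec.const ()) Primrec.id)

theorem primrec_numeral : Primrec numeral := by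
  have hsucc : Primrec Term.succ := by
    refine Primrec.encode_iff.1 ((?_ : Primrec fun t : Term => Nat.pair 1 (Nat.pair 1 (Nat.pair
      (PR.code .succ) (Encodable.encode [t.code])))).of_eq fun t => ?_)
    · exact Primrec₂.natPair.comp (Primrec.const _) (Primrec₂.natPair.comp (Primrec.const _)
        (Primrec₂.natPair.comp (Primrec.const _) (Primrec.encode.comp
          (Primrec.list_cons.comp Term.primrec_code (Primrec.const [])))))
    · rfl
  refine (Primrec.nat_rec₁ (f := fun _ t => Term.succ t) .zero (hsucc.comp Primrec.snd)).of_eq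
    fun n => ?_
  induction n with
  | zero => rfl
  | succ n ih => exact congrArg Term.succ ih

theorem Formula.primrec_inst : Primrec₂ Formula.inst :=
  Formula.primrec_subst.comp
    (Primrec.pair (Primrec.const 0) (primrec_numeral.comp Primrec.snd)) Primrec.fst

/-! ### Bounds for substituted terms -/

theorem Term.code_le_code_lift (t : Term) (c : ℕ) : t.code ≤ (t.lift c).code := by
  induction t with
  | var i =>
    simp only [Term.lift]
    split_ifs
    · exact le_rfl
    · exact pair_le_pair le_rfl (Nat.le_succ i)
  | app f ts ih =>
    exact pair_le_pair le_rfl (pair_le_pair le_rfl (pair_le_pair le_rfl (encode_ofFn_mono ih)))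

theorem Term.code_le_code_app {n : ℕ} (f : PR n) (ts : Fin n → Term) (j : Fin n) :
    (ts j).code ≤ (Term.app f ts).code :=
  (Term.code_lt_of_mem_args (by rw [Term.args_app]; exact List.mem_ofFn.2 ⟨j, rfl⟩)).le

/-- The cases are whether the variable `c` occurs. The dichotomy bounds the search for a substituted
term when only the result is given, as in the axiom `spec` and in the relation defining `g`. -/
theorem Term.subst_const_or_code_le (t : Term) (c : ℕ) :
    (∀ u u', t.subst c u = t.subst c u') ∨ ∀ u, u.code ≤ (t.subst c u).code := by
  induction t with
  | var i =>
    by_cases h : i = c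
    · right; subst h; simp [Term.subst]
    · left; simp [Term.subst, h]
  | app f ts ih =>
    by_cases h : ∃ j, ∀ u : Term, u.code ≤ ((ts j).subst c u).code
    · obtain ⟨j, hj⟩ := h
      exact .inr fun u => (hj u).trans (Term.code_le_code_app f (fun j => (ts j).subst c u) j)
    · push Not at h
      refine .inl fun u u' => congrArg (Term.app f) (funext fun j => ?_)
      rcases ih j with h' | h'
      · exact h' u u'
      · obtain ⟨u, hu⟩ := h j
        exact absurd (h' u) hu.not_ge

/-- Either the substituted term does not matter, or the result contains it. -/
theorem Formula.subst_const_or_code_le (A : Formula) :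
    ∀ c : ℕ, (∀ u u', A.subst c u = A.subst c u') ∨ ∀ u, u.code ≤ (A.subst c u).code := by
  induction A with
  | eq s t =>
    intro c
    rcases s.subst_const_or_code_le c with h | h
    · rcases t.subst_const_or_code_le c with h' | h'
      · exact .inl fun u u' => congrArg₂ Formula.eq (h u u') (h' u u')
      · exact .inr fun u => (h' u).trans ((Nat.right_le_pair _ _).trans (Nat.right_le_pair _ _))
    · exact .inr fun u => (h u).trans ((Nat.left_le_pair _ _).trans (Nat.right_le_pair _ _))
  | neg A ih =>
    intro c
    rcases ih c with h | h
    · exact .inl fun u u' => congrArg Formula.neg (h u u')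
    · exact .inr fun u => (h u).trans (Nat.right_le_pair _ _)
  | imp A B ihA ihB =>
    intro c
    rcases ihA c with h | h
    · rcases ihB c with h' | h'
      · exact .inl fun u u' => congrArg₂ Formula.imp (h u u') (h' u u')
      · exact .inr fun u => (h' u).trans ((Nat.right_le_pair _ _).trans (Nat.right_le_pair _ _))
    · exact .inr fun u => (h u).trans ((Nat.left_le_pair _ _).trans (Nat.right_le_pair _ _))
  | all A ih =>
    intro c
    rcases ih (c + 1) with h | h
    · exact .inl fun u u' => congrArg Formula.all (h _ _)
    -- Under the quantifier it is the lift of `u` that gets substituted, and lifting does not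
    -- decrease codes.
    · exact .inr fun u => (u.code_le_code_lift 0).trans ((h _).trans (Nat.right_le_pair _ _))

theorem le_code_numeral (n : ℕ) : n ≤ (numeral n).code := by
  induction n with
  | zero => exact Nat.zero_le _
  | succ n ih =>
    refine Nat.succ_le_of_lt (ih.trans_lt (Term.code_lt_of_mem_args ?_))
    rw [numeral, Term.succ, Term.args_app]
    simp

/-! ### The logical axioms -/

/-- Existential quantifiers over objects with bounded codes are primitive recursive. -/
theorem primrecPred_exists_of_bound {α β : Type*} [Primcodable α] [Primcodable β]
    {R : α → β → Prop} {m : α → ℕ} (hR : PrimrecRel R) (hm : Primrec m)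
    (h : ∀ a b, R a b → ∃ b', R a b' ∧ Encodable.encode b' ≤ m a) :
    PrimrecPred fun a => ∃ b, R a b := by
  have h1 : PrimrecRel fun (c : ℕ) (a : α) => ∃ b ∈ (Encodable.decode (α := β) c).toList, R a b :=
    hR.swap.exists_mem_list.comp
      (Primrec.optionToList.comp (Primrec.decode.comp Primrec.fst)) Primrec.snd
  refine (h1.exists_mem_list.comp (Primrec.list_range.comp (Primrec.succ.comp hm))
    Primrec.id).of_eq fun a => ⟨?_, ?_⟩
  · rintro ⟨_, _, b, _, hb⟩
    exact ⟨b, hb⟩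
  · rintro ⟨b, hb⟩
    obtain ⟨b', hb', hle⟩ := h a b hb
    exact ⟨Encodable.encode b', by simpa using! Nat.lt_succ_of_le hle, b', by simp, hb'⟩

theorem encode_prod_le {α β : Type*} [Encodable α] [Encodable β] {a : α} {b : β} {m n : ℕ}
    (ha : Encodable.encode a ≤ m) (hb : Encodable.encode b ≤ n) :
    Encodable.encode (a, b) ≤ Nat.pair m n := by
  rw [Encodable.encode_prod_val]
  exact pair_le_pair ha hb

namespace Formula

theorem code_left_le (A B : Formula) : A.code ≤ (A.imp B).code :=
  (Nat.left_le_pair _ _).trans (Nat.right_le_pair _ _)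

theorem code_right_le (A B : Formula) : B.code ≤ (A.imp B).code :=
  (Nat.right_le_pair _ _).trans (Nat.right_le_pair _ _)

theorem code_all_le (A : Formula) : A.code ≤ A.all.code := Nat.right_le_pair _ _

theorem code_lhs_le (s t : Term) : s.code ≤ (eq s t).code :=
  (Nat.left_le_pair _ _).trans (Nat.right_le_pair _ _)

theorem code_rhs_le (s t : Term) : t.code ≤ (eq s t).code :=
  (Nat.right_le_pair _ _).trans (Nat.right_le_pair _ _)

end Formula

section

open Formula

variable {α : Type*} [Primcodable α]

theorem _root_.Primrec.formulaImp {f g : α → Formula} (hf : Primrec f) (hg : Primrec g) :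
    Primrec fun a => (f a).imp (g a) := primrec_imp.comp hf hg

theorem _root_.Primrec.formulaEq {f g : α → Term} (hf : Primrec f) (hg : Primrec g) :
    Primrec fun a => Formula.eq (f a) (g a) := primrec_eq.comp hf hg

end

/-- The congruence axioms, in terms of primitive recursive operations. -/
theorem congr_axiom_iff (F : Formula) :
    (∃ (n : ℕ) (f : PR n) (ts : Fin n → Term) (i : Fin n) (s t : Term),
      F = .imp (.eq s t)
        (.eq (.app f (Function.update ts i s)) (.app f (Function.update ts i t)))) ↔
    ∃ q : Term × Term × Term × ℕ, F = .imp (.eq q.1 q.2.1)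
      (.eq q.2.2.1 (q.2.2.1.rebuild (q.2.2.1.args.set q.2.2.2 q.2.1))) ∧
        q.2.2.1.args[q.2.2.2]? = some q.1 := by
  have ofFn_set : ∀ {n : ℕ} (ts : Fin n → Term) (i : Fin n) (t : Term),
      (List.ofFn ts).set i t = List.ofFn (Function.update ts i t) := by
    intro n ts i t
    refine List.ext_getElem (by simp) fun j h1 h2 => ?_
    simp only [List.getElem_set, List.getElem_ofFn, Function.update_apply, Fin.ext_iff, eq_comm]
  constructor
  · rintro ⟨n, f, ts, i, s, t, rfl⟩
    -- The whole left-hand term carries the symbol, its arity and the other arguments, so no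
    -- dependent data remain to be quantified.
    refine ⟨(s, t, .app f (Function.update ts i s), i), ?_, by simp⟩
    simp [ofFn_set]
  · rintro ⟨⟨s, t, a, i⟩, rfl, h⟩
    dsimp only at h ⊢
    cases a with
    | var k => simp [Term.args, Term.code] at h
    | @app n f ts =>
      rw [Term.args_app] at h ⊢
      obtain ⟨hi, hs⟩ := List.getElem?_eq_some_iff.1 h
      rw [List.length_ofFn] at hi
      rw [List.getElem_ofFn] at hs
      refine ⟨n, f, ts, ⟨i, hi⟩, s, t, ?_⟩
      rw [ofFn_set ts ⟨i, hi⟩, Term.rebuild_app, ← hs, Function.update_eq_self]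

open Formula _root_.Primrec in
theorem primrecPred_logicalAxiom : PrimrecPred LogicalAxiom := by
  have hc : Primrec fun F : Formula => Nat.pair F.code F.code :=
    Primrec₂.natPair.comp primrec_code primrec_code
  have hc3 : Primrec fun F : Formula => Nat.pair F.code (Nat.pair F.code F.code) :=
    Primrec₂.natPair.comp primrec_code hc
  have imp₁ : PrimrecPred fun F : Formula =>
      ∃ q : Formula × Formula, F = q.1.imp (q.2.imp q.1) := by
    refine primrecPred_exists_of_bound (primrecPred_eq fst ?_) hc ?_
    · have h1 := fst.comp (snd (α := Formula) (β := Formula × Formula))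
      have h2 := snd.comp (snd (α := Formula) (β := Formula × Formula))
      exact h1.formulaImp (h2.formulaImp h1)
    · rintro _ ⟨A, B⟩ rfl
      exact ⟨_, rfl, encode_prod_le (code_left_le _ _)
        ((code_left_le _ _).trans (code_right_le _ _))⟩
  have imp₂ : PrimrecPred fun F : Formula => ∃ q : Formula × Formula × Formula,
      F = (q.1.imp (q.2.1.imp q.2.2)).imp ((q.1.imp q.2.1).imp (q.1.imp q.2.2)) := by
    refine primrecPred_exists_of_bound (primrecPred_eq fst ?_) hc3 ?_
    · have h := snd (α := Formula) (β := Formula × Formula × Formula)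
      have h1 := fst.comp h
      have h2 := fst.comp (snd.comp h)
      have h3 := snd.comp (snd.comp h)
      exact (h1.formulaImp (h2.formulaImp h3)).formulaImp ((h1.formulaImp h2).formulaImp (h1.formulaImp h3))
    · rintro _ ⟨A, B, C⟩ rfl
      have h := code_left_le (A.imp (B.imp C)) ((A.imp B).imp (A.imp C))
      have h' := (code_right_le A (B.imp C)).trans h
      exact ⟨_, rfl, encode_prod_le ((code_left_le _ _).trans h)
        (encode_prod_le ((code_left_le _ _).trans h') ((code_right_le _ _).trans h'))⟩
  have contra : PrimrecPred fun F : Formula =>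
      ∃ q : Formula × Formula, F = (q.1.neg.imp q.2.neg).imp (q.2.imp q.1) := by
    refine primrecPred_exists_of_bound (primrecPred_eq fst ?_) hc ?_
    · have h1 := fst.comp (snd (α := Formula) (β := Formula × Formula))
      have h2 := snd.comp (snd (α := Formula) (β := Formula × Formula))
      exact ((primrec_neg.comp h1).formulaImp (primrec_neg.comp h2)).formulaImp (h2.formulaImp h1)
    · rintro _ ⟨A, B⟩ rfl
      exact ⟨_, rfl, encode_prod_le ((code_right_le _ _).trans (code_right_le _ _))
        ((code_left_le _ _).trans (code_right_le _ _))⟩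
  have spec : PrimrecPred fun F : Formula =>
      ∃ q : Formula × Term, F = q.1.all.imp (q.1.subst 0 q.2) := by
    refine primrecPred_exists_of_bound (primrecPred_eq fst ?_) hc ?_
    · have h1 := fst.comp (snd (α := Formula) (β := Formula × Term))
      have h2 := snd.comp (snd (α := Formula) (β := Formula × Term))
      exact (primrec_all.comp h1).formulaImp (primrec_subst.comp (Primrec.pair (Primrec.const 0) h2) h1)
    · rintro _ ⟨A, t⟩ rfl
      have hA := (code_all_le A).trans (code_left_le A.all (A.subst 0 t))
      rcases A.subst_const_or_code_le 0 with h | h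
      -- If `t` leaves no trace in the axiom, `var 0` does as well, and its code is `0`.
      · exact ⟨(A, .var 0), by rw [h t (.var 0)], encode_prod_le hA (Nat.zero_le _)⟩
      · exact ⟨_, rfl, encode_prod_le hA ((h t).trans (code_right_le _ _))⟩
  have dist : PrimrecPred fun F : Formula =>
      ∃ q : Formula × Formula, F = (q.1.imp q.2).all.imp (q.1.all.imp q.2.all) := by
    refine primrecPred_exists_of_bound (primrecPred_eq fst ?_) hc ?_
    · have h1 := fst.comp (snd (α := Formula) (β := Formula × Formula))
      have h2 := snd.comp (snd (α := Formula) (β := Formula × Formula))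
      exact (primrec_all.comp (h1.formulaImp h2)).formulaImp ((primrec_all.comp h1).formulaImp (primrec_all.comp h2))
    · rintro _ ⟨A, B⟩ rfl
      have h := (code_all_le (A.imp B)).trans (code_left_le _ (A.all.imp B.all))
      exact ⟨_, rfl, encode_prod_le ((code_left_le _ _).trans h) ((code_right_le _ _).trans h)⟩
  have vacuous : PrimrecPred fun F : Formula => ∃ A : Formula, F = A.imp (A.lift 0).all := by
    refine primrecPred_exists_of_bound (primrecPred_eq fst ?_) primrec_code ?_
    · exact snd.formulaImp (primrec_all.comp (primrec_lift.comp (Primrec.const 0) snd))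
    · rintro _ A rfl
      exact ⟨A, rfl, code_left_le _ _⟩
  have refl : PrimrecPred fun F : Formula => ∃ t : Term, F = .eq t t := by
    refine primrecPred_exists_of_bound (primrecPred_eq fst ?_) primrec_code ?_
    · exact snd.formulaEq snd
    · rintro _ t rfl
      exact ⟨t, rfl, code_lhs_le _ _⟩
  have eucl : PrimrecPred fun F : Formula => ∃ q : Term × Term × Term,
      F = (Formula.eq q.1 q.2.1).imp ((Formula.eq q.1 q.2.2).imp (.eq q.2.1 q.2.2)) := by
    refine primrecPred_exists_of_bound (primrecPred_eq fst ?_) hc3 ?_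
    · have h := snd (α := Formula) (β := Term × Term × Term)
      have h1 := fst.comp h
      have h2 := fst.comp (snd.comp h)
      have h3 := snd.comp (snd.comp h)
      exact (h1.formulaEq h2).formulaImp ((h1.formulaEq h3).formulaImp (h2.formulaEq h3))
    · rintro _ ⟨s, t, u⟩ rfl
      have h := (code_right_le (.eq s u) (.eq t u)).trans (code_right_le (.eq s t) _)
      exact ⟨_, rfl, encode_prod_le ((code_lhs_le _ _).trans (code_left_le _ _))
        (encode_prod_le ((code_lhs_le _ _).trans h) ((code_rhs_le _ _).trans h))⟩
  have congr : PrimrecPred fun F : Formula => ∃ q : Term × Term × Term × ℕ,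
      F = .imp (.eq q.1 q.2.1)
        (.eq q.2.2.1 (q.2.2.1.rebuild (q.2.2.1.args.set q.2.2.2 q.2.1))) ∧
        q.2.2.1.args[q.2.2.2]? = some q.1 := by
    refine primrecPred_exists_of_bound
      (m := fun F => Nat.pair F.code (Nat.pair F.code (Nat.pair F.code F.code)))
      (.and (primrecPred_eq fst ?_) (primrecPred_eq ?_ ?_))
      (Primrec₂.natPair.comp primrec_code hc3) ?_
    · have h := snd (α := Formula) (β := Term × Term × Term × ℕ)
      have h1 := fst.comp h
      have h2 := fst.comp (snd.comp h)
      have h3 := fst.comp (snd.comp (snd.comp h))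
      have h4 := snd.comp (snd.comp (snd.comp h))
      exact (h1.formulaEq h2).formulaImp (h3.formulaEq (Term.primrec_rebuild.comp h3
        (list_set.comp (Term.primrec_args.comp h3) (h4.pair h2))))
    · have h := snd (α := Formula) (β := Term × Term × Term × ℕ)
      exact list_getElem?.comp (Term.primrec_args.comp (fst.comp (snd.comp (snd.comp h))))
        (snd.comp (snd.comp (snd.comp h)))
    · exact option_some.comp (fst.comp (snd (α := Formula) (β := Term × Term × Term × ℕ)))
    · rintro _ ⟨s, t, a, i⟩ ⟨rfl, h⟩
      dsimp only at h
      -- The position is less than the arity, and the arity is recorded in the code of `a`.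
      have hi : i ≤ a.code := by
        obtain ⟨hi, -⟩ := List.getElem?_eq_some_iff.1 h
        cases a with
        | var k => simp [Term.args, Term.code] at h
        | @app n f ts =>
          rw [Term.args_app, List.length_ofFn] at hi
          exact hi.le.trans ((Nat.left_le_pair _ _).trans (Nat.right_le_pair _ _))
      have ha := (code_lhs_le a (a.rebuild (a.args.set i t))).trans
        (code_right_le (.eq s t) _)
      exact ⟨_, ⟨rfl, h⟩, encode_prod_le ((code_lhs_le _ _).trans (code_left_le _ _))
        (encode_prod_le ((code_rhs_le _ _).trans (code_left_le _ _))
          (encode_prod_le ha (hi.trans ha)))⟩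
  refine (imp₁.or (imp₂.or (contra.or (spec.or (dist.or (vacuous.or (refl.or
    (eucl.or congr)))))))).of_eq fun F => ?_
  rw [← congr_axiom_iff]
  constructor
  · rintro (⟨⟨A, B⟩, rfl⟩ | ⟨⟨A, B, C⟩, rfl⟩ | ⟨⟨A, B⟩, rfl⟩ | ⟨⟨A, t⟩, rfl⟩ | ⟨⟨A, B⟩, rfl⟩ |
      ⟨A, rfl⟩ | ⟨t, rfl⟩ | ⟨⟨s, t, u⟩, rfl⟩ | ⟨n, f, ts, i, s, t, rfl⟩)
    · exact .imp₁ A B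
    · exact .imp₂ A B C
    · exact .contra A B
    · exact .spec A t
    · exact .dist A B
    · exact .vacuous A
    · exact .refl t
    · exact .eucl s t u
    · exact .congr f ts i s t
  · intro h
    cases h with
    | imp₁ A B => exact .inl ⟨(A, B), rfl⟩
    | imp₂ A B C => exact .inr (.inl ⟨(A, B, C), rfl⟩)
    | contra A B => exact .inr (.inr (.inl ⟨(A, B), rfl⟩))
    | spec A t => exact .inr (.inr (.inr (.inl ⟨(A, t), rfl⟩)))
    | dist A B => exact .inr (.inr (.inr (.inr (.inl ⟨(A, B), rfl⟩))))
    | vacuous A => exact .inr (.inr (.inr (.inr (.inr (.inl ⟨A, rfl⟩)))))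
    | refl t => exact .inr (.inr (.inr (.inr (.inr (.inr (.inl ⟨t, rfl⟩))))))
    | eucl s t u => exact .inr (.inr (.inr (.inr (.inr (.inr (.inr (.inl ⟨(s, t, u), rfl⟩)))))))
    | congr f ts i s t =>
      exact .inr (.inr (.inr (.inr (.inr (.inr (.inr (.inr ⟨_, f, ts, i, s, t, rfl⟩)))))))

/-! ### The proof predicate -/

theorem IsArithmeticalSystem.primrecPred_mem (hS : IsArithmeticalSystem S) :
    PrimrecPred fun A => A ∈ S :=
  (hS.primrec.comp Formula.primrec_code).of_eq fun A =>
    ⟨fun ⟨_, hB, h⟩ => Formula.code_injective h ▸ hB, fun h => ⟨A, h, rfl⟩⟩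

theorem IsArithmeticalSystem.primrecPred_isProof (hS : IsArithmeticalSystem S) :
    PrimrecPred (IsProof S) := by
  classical
  have hmem : PrimrecRel fun (A : Formula) (l : List Formula) => A ∈ l :=
    (PrimrecRel.exists_mem_list (R := fun B A : Formula => B = A) Primrec.eq).swap.of_eq
      fun A l => by simp [Function.swap]
  have hmp : PrimrecPred fun q : Formula × List Formula =>
      ∃ B ∈ q.2, Formula.imp B q.1 ∈ q.2 :=
    (PrimrecRel.exists_mem_list
      (R := fun (B : Formula) (q : Formula × List Formula) => Formula.imp B q.1 ∈ q.2)
      (hmem.comp (Primrec.fst.formulaImp (Primrec.fst.comp Primrec.snd))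
        (Primrec.snd.comp Primrec.snd))).comp Primrec.snd Primrec.id
  have hgen : PrimrecPred fun q : Formula × List Formula => ∃ B ∈ q.2, q.1 = .all B :=
    (PrimrecRel.exists_mem_list
      (R := fun (B : Formula) (q : Formula × List Formula) => q.1 = .all B)
      (primrecPred_eq (Primrec.fst.comp Primrec.snd)
        (Formula.primrec_all.comp Primrec.fst))).comp Primrec.snd Primrec.id
  have hstep : PrimrecPred fun q : Formula × List Formula =>
      LogicalAxiom q.1 ∨ q.1 ∈ S ∨ (∃ B ∈ q.2, Formula.imp B q.1 ∈ q.2) ∨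
        ∃ B ∈ q.2, q.1 = .all B :=
    (primrecPred_logicalAxiom.comp Primrec.fst).or
      ((hS.primrecPred_mem.comp Primrec.fst).or (hmp.or hgen))
  have hq : Primrec fun q : List Formula × Formula × List Formula × Bool =>
      (q.2.1, q.2.2.1) := Primrec.pair (Primrec.fst.comp Primrec.snd)
    (Primrec.fst.comp (Primrec.snd.comp Primrec.snd))
  refine Primrec.primrecPred ((Primrec.list_rec (f := id) (g := fun _ => true)
    (h := fun _ q => decide (LogicalAxiom q.1 ∨ q.1 ∈ S ∨
      (∃ B ∈ q.2.1, Formula.imp B q.1 ∈ q.2.1) ∨ ∃ B ∈ q.2.1, q.1 = .all B) && q.2.2)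
    Primrec.id (Primrec.const true) ?_).of_eq fun l => ?_)
  · exact Primrec.and.comp (hstep.comp hq).decide
      (Primrec.snd.comp (Primrec.snd.comp Primrec.snd))
  · induction l with
    | nil => exact (decide_eq_true (p := IsProof S []) trivial).symm
    | cons A l ih =>
      refine Eq.trans ?_ ((Bool.decide_and _ _).symm.trans (decide_eq_decide.2 Iff.rfl))
      exact congrArg (_ && ·) ih

theorem IsArithmeticalSystem.primrecRel_proves (hS : IsArithmeticalSystem S) :
    PrimrecRel (Proves S) := by
  have h : PrimrecRel fun (l : List Formula) (A : Formula) => IsProof S l ∧ l.head? = some A :=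
    (hS.primrecPred_isProof.comp Primrec.fst).and (primrecPred_eq
      (Primrec.list_head?.comp Primrec.fst) (Primrec.option_some.comp Primrec.snd))
  -- `decode₂` rejects numbers that are not the code of what they decode to, so `p` is exactly the
  -- code of `l`.
  have h' : PrimrecRel fun (p : ℕ) (A : Formula) =>
      ∃ l ∈ (Encodable.decode₂ (List Formula) p).toList, IsProof S l ∧ l.head? = some A :=
    h.exists_mem_list.comp (Primrec.optionToList.comp (Primrec.decode₂.comp Primrec.fst))
      Primrec.snd
  refine h'.of_eq fun p A => ⟨?_, ?_⟩
  · rintro ⟨l, hl, h, hA⟩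
    cases l with
    | nil => simp at hA
    | cons B l =>
      obtain rfl : B = A := by simpa using hA
      refine ⟨l, h, ?_⟩
      rw [codeSeq_eq_encode]
      exact (Encodable.mem_decode₂.1 (by simpa using hl)).symm
  · rintro ⟨l, h, rfl⟩
    exact ⟨A :: l, by rw [codeSeq_eq_encode, Encodable.encodek₂]; simp, h, rfl⟩

/-- Used twice over: it bounds the searches that define `f` and `g`, and it makes the descent in
`not_provable_starContracted` strict. -/
theorem Proves.code_lt {p : ℕ} {A : Formula} (h : Proves S p A) : A.code < p := by
  obtain ⟨l, -, rfl⟩ := h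
  exact lt_encode_list_of_mem (by simp)

/-- A proof proves only its last formula, which its code determines; so the statement proved by `x₁`
is unambiguous. -/
theorem Proves.unique {p : ℕ} {A B : Formula} (h : Proves S p A) (h' : Proves S p B) : A = B := by
  obtain ⟨l, -, rfl⟩ := h
  obtain ⟨l', -, h⟩ := h'
  rw [codeSeq_eq_encode, codeSeq_eq_encode] at h
  exact (List.cons.inj (Encodable.encode_injective h)).1

theorem ProvesPi₂.code_lt {p : ℕ} {A : Formula} (h : ProvesPi₂ S p A) : A.code < p := by
  refine lt_of_le_of_lt ?_ h.2.2.code_lt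
  exact (Nat.right_le_pair 1 _).trans ((Nat.right_le_pair 3 _).trans
    ((Nat.right_le_pair 1 _).trans (Nat.right_le_pair 3 _)))

theorem ProvesPi₂.unique {p : ℕ} {A B : Formula} (h : ProvesPi₂ S p A) (h' : ProvesPi₂ S p B) :
    A = B := by
  have := h.2.2.unique h'.2.2
  simpa [Formula.ex] using this

theorem Formula.inst₂_const_or_le_code (A : Formula) (m : ℕ) :
    (∀ n n', A.inst₂ m n = A.inst₂ m n') ∨ ∀ n, n ≤ (A.inst₂ m n).code := by
  simp only [Formula.inst₂_eq]
  rcases (A.subst 1 (numeral m)).subst_const_or_code_le 0 with h | h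
  · exact .inl fun n n' => h _ _
  · exact .inr fun n => (le_code_numeral n).trans (h _)

theorem IsArithmeticalSystem.primrecRel_provesPi₂ (hS : IsArithmeticalSystem S) :
    PrimrecRel (ProvesPi₂ S) := by
  have hex : Primrec fun A : Formula => A.ex.all :=
    Formula.primrec_all.comp (Formula.primrec_neg.comp
      (Formula.primrec_all.comp Formula.primrec_neg))
  exact (Formula.primrecPred_quantifierFree.comp Primrec.snd).and
    ((Formula.primrecRel_below.comp (Primrec.const 2) Primrec.snd).and
      (hS.primrecRel_proves.comp Primrec.fst (hex.comp Primrec.snd)))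

theorem IsArithmeticalSystem.primrecPred_provesPi₂ (hS : IsArithmeticalSystem S) :
    PrimrecPred fun p => ∃ A, ProvesPi₂ S p A :=
  primrecPred_exists_of_bound hS.primrecRel_provesPi₂ Primrec.id
    fun _ A h => ⟨A, h, h.code_lt.le⟩

theorem IsArithmeticalSystem.primrecPred_provesInstance (hS : IsArithmeticalSystem S) :
    PrimrecPred fun q : ℕ × ℕ × ℕ =>
      ∃ A, ProvesPi₂ S q.1 A ∧ ∃ n, Proves S q.2.2 (A.inst₂ q.2.1 n) := by
  have hb := Primrec.fst (α := ℕ × ℕ × ℕ) (β := Formula × ℕ)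
  have hA := Primrec.fst.comp (Primrec.snd (α := ℕ × ℕ × ℕ) (β := Formula × ℕ))
  have hn := Primrec.snd.comp (Primrec.snd (α := ℕ × ℕ × ℕ) (β := Formula × ℕ))
  have h : PrimrecPred fun q : ℕ × ℕ × ℕ => ∃ b : Formula × ℕ,
      ProvesPi₂ S q.1 b.1 ∧ Proves S q.2.2 (b.1.inst₂ q.2.1 b.2) := by
    refine primrecPred_exists_of_bound (m := fun q => Nat.pair q.1 q.2.2)
      (.and (hS.primrecRel_provesPi₂.comp (Primrec.fst.comp hb) hA)
        (hS.primrecRel_proves.comp (Primrec.snd.comp (Primrec.snd.comp hb)) ?_)) ?_ ?_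
    · exact Formula.primrec_inst.comp (Formula.primrec_inst.comp hA hn)
        (Primrec.fst.comp (Primrec.snd.comp hb))
    · exact Primrec₂.natPair.comp Primrec.fst (Primrec.snd.comp Primrec.snd)
    · rintro ⟨x₁, x₂, y⟩ ⟨A, n⟩ ⟨h, h'⟩
      dsimp only at h h'
      -- If `y` does not occur in `A(x₂, y)`, then `n` may be taken to be `0`; otherwise `n` is at
      -- most the code of the instance, which is below the code of its proof.
      rcases A.inst₂_const_or_le_code x₂ with hc | hc
      · refine ⟨(A, 0), ⟨h, ?_⟩, encode_prod_le h.code_lt.le (Nat.zero_le _)⟩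
        dsimp only
        rw [hc 0 n]
        exact h'
      · exact ⟨(A, n), ⟨h, h'⟩, encode_prod_le h.code_lt.le ((hc n).trans h'.code_lt.le)⟩
  refine h.of_eq fun q => ⟨?_, ?_⟩
  · rintro ⟨b, h1, h2⟩
    exact ⟨b.1, h1, b.2, h2⟩
  · rintro ⟨A, h1, n, h2⟩
    exact ⟨(A, n), h1, h2⟩

/-! ### Function symbols for primitive recursive functions -/

theorem exists_pr {n : ℕ} {f : List.Vector ℕ n → ℕ} (hf : Nat.Primrec' f) :
    ∃ F : PR n, ∀ v : Fin n → ℕ, F.eval v = f (List.Vector.ofFn v) := by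
  induction hf with
  | zero => exact ⟨.zero, fun _ => rfl⟩
  | succ => exact ⟨.succ, fun v => by simp [PR.eval]⟩
  | get i => exact ⟨.proj i, fun v => by simp [PR.eval]⟩
  | comp g _ _ ihf ihg =>
    obtain ⟨F, hF⟩ := ihf
    choose G hG using ihg
    exact ⟨.comp F G, fun v => by simp [PR.eval, hF, hG]⟩
  | prec _ _ ihf ihg =>
    obtain ⟨F, hF⟩ := ihf
    obtain ⟨G, hG⟩ := ihg
    refine ⟨.prec F G, fun v => ?_⟩
    obtain ⟨y, v, rfl⟩ : ∃ y w, v = Matrix.vecCons y w :=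
      ⟨Matrix.vecHead v, Matrix.vecTail v, (Matrix.cons_head_tail v).symm⟩
    have hcons : ∀ {m : ℕ} (a : ℕ) (w : Fin m → ℕ),
        List.Vector.ofFn (Matrix.vecCons a w) = a ::ᵥ List.Vector.ofFn w := fun _ _ => rfl
    rw [hcons]
    dsimp only
    rw [List.Vector.head_cons, List.Vector.tail_cons]
    induction y with
    | zero => exact hF v
    | succ y ih =>
      refine (hG _).trans ?_
      rw [hcons, hcons]
      dsimp only
      rw [← ih]
      rfl

theorem exists_pr_indicator {n : ℕ} {p : List.Vector ℕ n → Prop} (hp : PrimrecPred p) :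
    ∃ F : PR n, ∀ v : Fin n → ℕ, F.eval v = 1 ↔ p (List.Vector.ofFn v) := by
  classical
  obtain ⟨F, hF⟩ := exists_pr (Nat.Primrec'.of_prim
    (Primrec.ite hp (Primrec.const 1) (Primrec.const 0)))
  refine ⟨F, fun v => ?_⟩
  rw [hF]
  split_ifs with h <;> simp [h]

theorem IsArithmeticalSystem.exists_definesProvesPi₂ (hS : IsArithmeticalSystem S) :
    ∃ f : PR 1, DefinesProvesPi₂ S f := by
  obtain ⟨F, hF⟩ := exists_pr_indicator (n := 1)
    (hS.primrecPred_provesPi₂.comp Primrec.vector_head)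
  exact ⟨F, fun x => hF ![x]⟩

theorem IsArithmeticalSystem.exists_definesProvesInstance (hS : IsArithmeticalSystem S) :
    ∃ g : PR 3, DefinesProvesInstance S g := by
  obtain ⟨F, hF⟩ := exists_pr_indicator (n := 3) (hS.primrecPred_provesInstance.comp
    (Primrec.vector_head.pair ((Primrec.vector_head.comp Primrec.vector_tail).pair
      (Primrec.vector_head.comp (Primrec.vector_tail.comp Primrec.vector_tail)))))
  exact ⟨F, fun x₁ x₂ y => hF ![x₁, x₂, y]⟩

theorem exists_isPairing : ∃ (pr : PR 2) (l r : PR 1), IsPairing pr l r := by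
  obtain ⟨pr, hpr⟩ := exists_pr (n := 2) Nat.Primrec'.natPair
  obtain ⟨l, hl⟩ := exists_pr (n := 1) (Nat.Primrec'.unpair₁ Nat.Primrec'.head)
  obtain ⟨r, hr⟩ := exists_pr (n := 1) (Nat.Primrec'.unpair₂ Nat.Primrec'.head)
  refine ⟨pr, l, r, fun a b => ?_⟩
  rw [hl, hr, hpr]
  simp [List.Vector.ofFn]

/-! ### Consistency -/

theorem OneConsistent.not_inconsistent (h : OneConsistent S) : ¬ Inconsistent S := fun hi =>
  h ⟨.eq (.var 0) (.var 0), ⟨Nat.one_pos, Nat.one_pos⟩, trivial, hi.provable _,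
    fun _ => hi.provable _⟩

theorem OmegaConsistent.twoConsistent (h : OmegaConsistent S) : TwoConsistent S :=
  fun ⟨A, hA, _, h1, h2⟩ => h ⟨A, hA, trivial, h1, h2⟩

theorem Term.Below.lift {t : Term} {n : ℕ} (h : t.Below n) (c : ℕ) : (t.lift c).Below (n + 1) := by
  induction t with
  | var i =>
    have hi : i < n := h
    simp only [Term.lift]
    split_ifs
    · exact hi.trans (Nat.lt_succ_self n)
    · exact Nat.succ_lt_succ hi
  | app f ts ih => exact fun j => ih j (h j)

theorem Formula.Below.lift {A : Formula} :
    ∀ {n : ℕ}, A.Below n → ∀ c, (A.lift c).Below (n + 1) := by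
  induction A with
  | eq s t => intro n h c; exact ⟨h.1.lift c, h.2.lift c⟩
  | neg A ih => intro n h c; exact ih (n := n) h c
  | imp A B ihA ihB => intro n h c; exact ⟨ihA h.1 c, ihB h.2 c⟩
  | all A ih => intro n h c; exact ih (n := n + 1) h (c + 1)

theorem Formula.QuantifierFree.lift {A : Formula} (h : A.QuantifierFree) (c : ℕ) :
    (A.lift c).QuantifierFree := by
  induction A with
  | eq s t => trivial
  | neg A ih => exact ih h
  | imp A B ihA ihB => exact ⟨ihA h.1, ihB h.2⟩
  | all A ih => exact h.elim

theorem Term.subst_lift_comm (t : Term) {u : Term} (hu : u.Below 0) (c : ℕ) :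
    (t.lift 0).subst (c + 1) u = (t.subst c u).lift 0 := by
  induction t with
  | var i =>
    rcases Nat.lt_trichotomy i c with h | rfl | h
    · simp [Term.lift, Term.subst, h]
    · simp [Term.lift, Term.subst, hu.lift_eq le_rfl]
    · have h1 : ¬ i < c := by omega
      have h2 : i ≠ c := by omega
      simp only [Term.lift, Nat.not_lt_zero, if_false, Term.subst, Nat.add_lt_add_iff_right, h1,
        Nat.add_right_cancel_iff, h2]
      congr 1
      omega
  | app f ts ih => simp [Term.lift, Term.subst, ih]

theorem Formula.QuantifierFree.subst_lift_comm {A : Formula} (h : A.QuantifierFree) {u : Term}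
    (hu : u.Below 0) (c : ℕ) : (A.lift 0).subst (c + 1) u = (A.subst c u).lift 0 := by
  induction A with
  | eq s t => simp [Formula.lift, Formula.subst, Term.subst_lift_comm _ hu]
  | neg A ih => simp [Formula.lift, Formula.subst, ih h]
  | imp A B ihA ihB => simp [Formula.lift, Formula.subst, ihA h.1, ihB h.2]
  | all A ih => exact h.elim

/-- A quantifier-free `A` is padded with a dummy universal quantifier, since `IsPi₁` asks for a
formula that literally begins with one. -/
theorem TwoConsistent.oneConsistent (h : TwoConsistent S) : OneConsistent S := by
  rintro ⟨A, hA, hq, hex, hneg⟩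
  refine h ⟨.all (A.lift 0), hA.lift 0, ⟨_, hq.lift 0, rfl⟩, ?_, fun n => ?_⟩
  · refine Entails.ex_elim (Γ := []) (C := .ex (.all (A.lift 0))) hex ?_
    refine Entails.ex_intro (A := .all ((A.lift 0).lift 2)) (.var 0) (Entails.gen ?_)
    change Entails S [A.lift 0] (((A.lift 0).lift (1 + 1)).subst 1 (.var 1))
    rw [(A.lift 0).subst_lift_succ 1]
    exact Entails.hyp (by simp)
  · change Provable S (.neg (.all ((A.lift 0).subst 1 ((numeral n).lift 0))))
    rw [numeral_lift, hq.subst_lift_comm (numeral_below n) 0]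
    refine Entails.neg_intro (Γ := []) (Entails.absurd (A := A.inst n) ?_ (hneg n).entails)
    have := Entails.spec (S := S) (Γ := [.all ((A.inst n).lift 0)])
      (Entails.hyp (List.mem_singleton_self _)) .zero
    rwa [Formula.subst_lift] at this

/-! ### Instances of provable statements -/

/-- In the 1-consistent case, if no instance at `x` were provable, decidability would make all of
them refutable, although `∃y A(x, y)` is provable. -/
theorem IsArithmeticalSystem.exists_provable_inst₂ (hS : IsArithmeticalSystem S)
    (h : Inconsistent S ∨ OneConsistent S) {p : ℕ} {A : Formula} (hA : ProvesPi₂ S p A) (x : ℕ) :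
    ∃ n, Provable S (A.inst₂ x n) := by
  rcases h with h | h
  · exact ⟨0, h.provable _⟩
  · by_contra! hn
    have hfalse : ∀ n, Provable S (.neg (A.inst₂ x n)) := fun n => by
      have hd := hS.decides (hA.1.inst₂ x n) (hA.2.1.inst₂ x n) fun _ => 0
      exact hd.2 fun ht => hn n (hd.1 ht)
    refine h ⟨A.subst 1 (numeral x), hA.2.1.subst (numeral_below x) le_rfl, hA.1.subst _ _, ?_,
      fun n => ?_⟩
    · have h1 : Provable S (.all A.ex) := ⟨p, hA.2.2⟩
      have := h1.spec (numeral x)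
      simpa only [Formula.ex, Formula.subst, numeral_lift] using this
    · rw [← Formula.inst₂_eq]
      exact hfalse n

/-- If `x₁` proves a `Π⁰₂` statement, then some number proves an instance of it at `x₂`. -/
theorem IsArithmeticalSystem.exists_eval_eq_one (hS : IsArithmeticalSystem S) {f : PR 1} {g : PR 3}
    (hf : DefinesProvesPi₂ S f) (hg : DefinesProvesInstance S g)
    (h : Inconsistent S ∨ OneConsistent S) (x₁ x₂ : ℕ) (hx : f.eval ![x₁] = 1) :
    ∃ y, g.eval ![x₁, x₂, y] = 1 := by
  obtain ⟨A, hA⟩ := (hf x₁).1 hx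
  obtain ⟨n, y, hy⟩ := hS.exists_provable_inst₂ h hA x₂
  exact ⟨y, (hg _ _ _).2 ⟨A, hA, n, hy⟩⟩

/-! ### Evaluation, lifting and substitution for terms with few arguments -/

theorem Term.eval_app₁ (f : PR 1) (a : Term) (v : ℕ → ℕ) :
    (Term.app f ![a]).eval v = f.eval ![a.eval v] := by
  simp only [Term.eval]; congr; funext j; fin_cases j; rfl

theorem Term.eval_app₂ (f : PR 2) (a b : Term) (v : ℕ → ℕ) :
    (Term.app f ![a, b]).eval v = f.eval ![a.eval v, b.eval v] := by
  simp only [Term.eval]; congr; funext j; fin_cases j <;> rfl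

theorem Term.eval_app₃ (f : PR 3) (a b c : Term) (v : ℕ → ℕ) :
    (Term.app f ![a, b, c]).eval v = f.eval ![a.eval v, b.eval v, c.eval v] := by
  simp only [Term.eval]; congr; funext j; fin_cases j <;> rfl

theorem Term.eval_var (i : ℕ) (v : ℕ → ℕ) : (Term.var i).eval v = v i := rfl

theorem Term.lift_app₁ (f : PR 1) (a : Term) (c : ℕ) :
    (Term.app f ![a]).lift c = .app f ![a.lift c] := by
  simp only [Term.lift]; congr; funext j; fin_cases j; rfl

theorem Term.lift_app₂ (f : PR 2) (a b : Term) (c : ℕ) :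
    (Term.app f ![a, b]).lift c = .app f ![a.lift c, b.lift c] := by
  simp only [Term.lift]; congr; funext j; fin_cases j <;> rfl

theorem Term.lift_var (i c : ℕ) :
    (Term.var i).lift c = if i < c then .var i else .var (i + 1) := rfl

theorem Term.subst_var (i c : ℕ) (u : Term) :
    (Term.var i).subst c u = if i < c then .var i else if i = c then u else .var (i - 1) := rfl

theorem Term.below_app₁ {f : PR 1} {a : Term} {n : ℕ} :
    (Term.app f ![a]).Below n ↔ a.Below n := by
  simp [Term.Below]

theorem Term.below_app₂ {f : PR 2} {a b : Term} {n : ℕ} :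
    (Term.app f ![a, b]).Below n ↔ a.Below n ∧ b.Below n := by
  simp [Term.Below, Fin.forall_fin_succ]

theorem Term.below_app₃ {f : PR 3} {a b c : Term} {n : ℕ} :
    (Term.app f ![a, b, c]).Below n ↔ a.Below n ∧ b.Below n ∧ c.Below n := by
  simp [Term.Below, Fin.forall_fin_succ]

theorem Term.below_var {i n : ℕ} : (Term.var i).Below n ↔ i < n := Iff.rfl

theorem numeral_below' (k n : ℕ) : (numeral k).Below n := by
  induction k with
  | zero => intro j; exact j.elim0
  | succ k ih => exact Term.below_app₁.2 ih

/-! ### The two forms of the statement -/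

section

variable {f : PR 1} {g : PR 3} {pr : PR 2} {l r : PR 1}

theorem star_isTrue_iff : (star f g).IsTrue ↔
    ∀ x₁ x₂, f.eval ![x₁] = 1 → ∃ y, g.eval ![x₁, x₂, y] = 1 := by
  simp [star, starMatrix, Formula.IsTrue, Formula.Holds, Formula.ex, Term.eval_app₁,
    Term.eval_app₃, Term.eval_var, extend]

theorem starContracted_isTrue_iff : (starContracted f g l r).IsTrue ↔
    ∀ z, ∃ y, f.eval ![l.eval ![z]] = 1 → g.eval ![l.eval ![z], r.eval ![z], y] = 1 := by
  simp only [starContracted, contractedMatrix, Formula.IsTrue, Formula.Holds, Formula.ex,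
    Term.eval_app₁, Term.eval_app₃, Term.eval_var, extend, numeral_eval, not_forall_not]
  exact ⟨fun h => h fun _ => 0, fun h _ => h⟩

theorem star_closed : (star f g).Closed := by
  simp [star, starMatrix, Formula.Closed, Formula.Below, Formula.ex, Term.below_app₁,
    Term.below_app₃, Term.below_var, numeral_below']

theorem starContracted_closed : (starContracted f g l r).Closed := by
  simp [starContracted, contractedMatrix, Formula.Closed, Formula.Below, Formula.ex,
    Term.below_app₁, Term.below_app₃, Term.below_var, numeral_below']

/-- Truth of the instance suffices: either a witness `y` can be verified in `S`, or the premise is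
false and `S` refutes it. -/
theorem IsArithmeticalSystem.provable_starMatrix_inst₂ (hS : IsArithmeticalSystem S)
    {x₁ x₂ : ℕ} (h : f.eval ![x₁] = 1 → ∃ y, g.eval ![x₁, x₂, y] = 1) :
    Provable S ((starMatrix f g).inst₂ x₁ x₂) := by
  have heq : (starMatrix f g).inst₂ x₁ x₂ = .imp (.eq (.app f ![numeral x₁]) (numeral 1))
      (.ex (.eq (.app g ![numeral x₁, numeral x₂, .var 0]) (numeral 1))) := by
    simp [starMatrix, Formula.inst₂, Formula.inst, Formula.ex, Formula.subst, Term.subst_app₁,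
      Term.subst_app₃, Term.subst_var]
  rw [heq]
  by_cases hx : f.eval ![x₁] = 1
  · obtain ⟨y, hy⟩ := h hx
    refine (LogicalAxiom.imp₁ _ _).provable.mp (Provable.ex_intro (numeral y) ?_)
    refine (hS.decides ?_ ?_ fun _ => 0).1 ?_
    · exact trivial
    · simp [Formula.subst, Formula.Below, Term.subst_app₃, Term.subst_var, Term.below_app₃,
        numeral_below']
    · simpa [Formula.subst, Formula.Holds, Term.subst_app₃, Term.subst_var, Term.eval_app₃]
  · refine Entails.absurd (Γ := [_]) (A := .eq (.app f ![numeral x₁]) (numeral 1))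
      (Entails.hyp (by simp)) (Provable.entails ((hS.decides ?_ ?_ fun _ => 0).2 ?_))
    · exact trivial
    · simp [Formula.Below, Term.below_app₁, numeral_below']
    · simpa [Formula.Holds, Term.eval_app₁]

theorem IsArithmeticalSystem.provable_contractedMatrix_inst (hS : IsArithmeticalSystem S) {z : ℕ}
    (h : ∃ y, f.eval ![l.eval ![z]] = 1 → g.eval ![l.eval ![z], r.eval ![z], y] = 1) :
    Provable S ((contractedMatrix f g l r).inst z) := by
  obtain ⟨y, hy⟩ := h
  have heq : (contractedMatrix f g l r).inst z =
      .ex (.imp (.eq (.app f ![.app l ![numeral z]]) (numeral 1))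
        (.eq (.app g ![.app l ![numeral z], .app r ![numeral z], .var 0]) (numeral 1))) := by
    simp [contractedMatrix, Formula.inst, Formula.ex, Formula.subst, Term.subst_app₁,
      Term.subst_app₃, Term.subst_var]
  rw [heq]
  refine Provable.ex_intro (numeral y) ((hS.decides ?_ ?_ fun _ => 0).1 ?_)
  · exact ⟨trivial, trivial⟩
  · simp [Formula.subst, Formula.Below, Term.subst_app₁, Term.subst_app₃, Term.subst_var,
      Term.below_app₁, Term.below_app₃, numeral_below']
  · simpa [Formula.subst, Formula.Holds, Term.subst_app₁, Term.subst_app₃, Term.subst_var,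
      Term.eval_app₁, Term.eval_app₃] using hy

theorem provable_star_imp_starContracted :
    Provable S (.imp (star f g) (starContracted f g l r)) := by
  refine Entails.gen (Γ := [star f g]) ?_
  rw [List.map_singleton, Formula.Below.lift_eq star_closed le_rfl]
  -- Taking `x₁ = l(z)` and `x₂ = r(z)` leaves only the existential quantifier to be moved to the
  -- front.
  have h := ((Entails.hyp (S := S) (List.mem_singleton_self (star f g))).spec
    (.app l ![.var 0])).spec (.app r ![.var 0])
  have := Entails.ex_imp_of_imp_ex (S := S) (Γ := [star f g])
    (A := .eq (.app f ![.app l ![.var 0]]) (numeral 1))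
    (B := .eq (.app g ![.app l ![.var 1], .app r ![.var 1], .var 0]) (numeral 1)) (by
      simpa [starMatrix, Formula.ex, Formula.subst, Term.subst_app₁, Term.subst_app₃,
        Term.subst_var, Term.lift_app₁, Term.lift_var] using h)
  simpa [contractedMatrix, Formula.lift, Term.lift_app₁, Term.lift_var] using this

theorem provable_app_eq_imp {n : ℕ} (F : PR n) {ts us : Fin n → Term} (t : Term)
    (h : ∀ j, Provable S (.eq (ts j) (us j))) :
    Provable S (.imp (.eq (.app F ts) t) (.eq (.app F us) t)) :=
  (LogicalAxiom.eucl _ _ _).provable.mp (Provable.app_congr F h)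

theorem provable_starContracted_imp_star (h : ProvesPairing S pr l r) :
    Provable S (.imp (starContracted f g l r) (star f g)) := by
  -- The pairing equations speak of the variables `1` and `0`; inside the existential quantifier of
  -- `(*)` these become `2` and `1`.
  have hl := (h.1.gen.gen.spec (.var 2)).spec (.var 1)
  have hr := (h.2.gen.gen.spec (.var 2)).spec (.var 1)
  simp [Formula.subst, Term.subst_app₁, Term.subst_app₂, Term.subst_var, Term.lift_var] at hl hr
  refine Entails.gen (Γ := [starContracted f g l r]) (Entails.gen ?_)
  rw [List.map_singleton, Formula.Below.lift_eq starContracted_closed le_rfl, List.map_singleton,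
    Formula.Below.lift_eq starContracted_closed le_rfl]
  have hc := (Entails.hyp (S := S) (List.mem_singleton_self (starContracted f g l r))).spec
    (.app pr ![.var 1, .var 0])
  have hx := Entails.imp_ex_of_ex_imp (S := S) (Γ := [starContracted f g l r])
    (A := .eq (.app f ![.app l ![.app pr ![.var 1, .var 0]]]) (numeral 1))
    (B := .eq (.app g ![.app l ![.app pr ![.var 2, .var 1]], .app r ![.app pr ![.var 2, .var 1]],
      .var 0]) (numeral 1)) (by
      simpa [contractedMatrix, Formula.ex, Formula.subst, Formula.lift, Term.subst_app₁,
        Term.subst_app₂, Term.subst_app₃, Term.subst_var, Term.lift_app₁, Term.lift_app₂,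
        Term.lift_var] using hc)
  change Entails S [.eq (.app f ![.var 1]) (numeral 1), starContracted f g l r] _
  refine Entails.ex_elim (Entails.mp hx.weaken (Entails.mp
    (provable_app_eq_imp f (numeral 1) fun j => ?_).entails (Entails.hyp List.mem_cons_self))) ?_
  · fin_cases j
    exact h.1.eq_symm
  · refine Entails.ex_intro (A := .lift 1 (.eq (.app g ![.var 2, .var 1, .var 0]) (numeral 1)))
      (.var 0) ?_
    rw [Formula.subst_lift_succ _ 0]
    refine Entails.mp (provable_app_eq_imp g (numeral 1) fun j => ?_).entails
      (Entails.hyp List.mem_cons_self)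
    fin_cases j
    · exact hl
    · exact hr
    · exact (LogicalAxiom.refl _).provable

/-! ### Unprovability and irrefutability of the contracted statement -/

/-- The matrix of the contracted statement for a pair with equal components:
`f(l(p)) = 1 ⊃ g(l(p), r(p), y) = 1` with `p = pr(x, x)`. -/
def diagonalMatrix (f : PR 1) (g : PR 3) (pr : PR 2) (l r : PR 1) : Formula :=
  .imp (.eq (.app f ![.app l ![.app pr ![.var 1, .var 1]]]) (numeral 1))
    (.eq (.app g ![.app l ![.app pr ![.var 1, .var 1]], .app r ![.app pr ![.var 1, .var 1]],
      .var 0]) (numeral 1))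

theorem diagonalMatrix_inst₂ (m n : ℕ) : (diagonalMatrix f g pr l r).inst₂ m n =
    .imp (.eq (.app f ![.app l ![.app pr ![numeral m, numeral m]]]) (numeral 1))
      (.eq (.app g ![.app l ![.app pr ![numeral m, numeral m]],
        .app r ![.app pr ![numeral m, numeral m]], numeral n]) (numeral 1)) := by
  simp [diagonalMatrix, Formula.inst₂, Formula.inst, Formula.subst, Term.subst_app₁,
    Term.subst_app₂, Term.subst_app₃, Term.subst_var]

theorem Provable.diagonal (h : Provable S (starContracted f g l r)) :
    Provable S (diagonalMatrix f g pr l r).ex.all := by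
  have := (h.spec (.app pr ![.var 0, .var 0])).gen
  simpa [contractedMatrix, diagonalMatrix, Formula.ex, Formula.subst, Term.subst_app₁,
    Term.subst_app₃, Term.subst_var, Term.lift_app₂, Term.lift_var] using this

/-- The diagonal form is needed because `(*)^c` has a single argument `z`: applying it to its own
proof `q` would require `l(z) = q` and `r(z) = z` at once. With `z = π(x, x)` the argument `x = q`
serves as both components. -/
theorem IsArithmeticalSystem.not_provable_starContracted (hS : IsArithmeticalSystem S)
    (hf : DefinesProvesPi₂ S f) (hg : DefinesProvesInstance S g) (hp : IsPairing pr l r)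
    (h1 : OneConsistent S) : ¬ Provable S (starContracted f g l r) := by
  intro hprov
  obtain ⟨q, hq⟩ := hprov.diagonal (pr := pr)
  have hD : ProvesPi₂ S q (diagonalMatrix f g pr l r) := by
    refine ⟨⟨trivial, trivial⟩, ?_, hq⟩
    simp [diagonalMatrix, Formula.Below, Term.below_app₁, Term.below_app₂, Term.below_app₃,
      Term.below_var, numeral_below']
  have hfq : f.eval ![q] = 1 := (hf q).2 ⟨_, hD⟩
  have hex : ∃ y, g.eval ![q, q, y] = 1 :=
    hS.exists_eval_eq_one hf hg (.inr h1) q q hfq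
  have descent : ∀ y, g.eval ![q, q, y] = 1 → ∃ n < y, g.eval ![q, q, n] = 1 := by
    intro y hy
    obtain ⟨A, hA, n, hn⟩ := (hg q q y).1 hy
    obtain rfl := hA.unique hD
    refine ⟨n, ?_, ?_⟩
    · refine lt_of_le_of_lt ((le_code_numeral n).trans ?_) hn.code_lt
      rw [diagonalMatrix_inst₂]
      refine le_trans ?_ (Formula.code_right_le _ _)
      refine le_trans ?_ (Formula.code_lhs_le _ _)
      exact Term.code_le_code_app g ![_, _, numeral n] 2
    -- The instance proved by `y` is true; by the pairing equations, which here need hold only for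
    -- numbers, its conclusion is `g(q, q, n) = 1`.
    · have ht := hS.holds_of_provable h1.not_inconsistent (hD.1.inst₂ q n) (hD.2.1.inst₂ q n)
        ⟨y, hn⟩ fun _ => 0
      rw [diagonalMatrix_inst₂] at ht
      simp only [Formula.Holds, Term.eval_app₁, Term.eval_app₂, Term.eval_app₃, numeral_eval,
        (hp q q).1, (hp q q).2] at ht
      exact ht hfq
  classical
  obtain ⟨n, hlt, hn⟩ := descent _ (Nat.find_spec hex)
  exact Nat.find_min hex hlt hn

theorem IsArithmeticalSystem.starContracted_independent (hS : IsArithmeticalSystem S)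
    (hf : DefinesProvesPi₂ S f) (hg : DefinesProvesInstance S g) (hp : IsPairing pr l r)
    (h2 : TwoConsistent S) : ¬ Provable S (starContracted f g l r) ∧
      ¬ Provable S (.neg (starContracted f g l r)) := by
  -- Since `∃` abbreviates `¬∀¬`, the negation of `(*)^c` is literally `∃z` applied to the formula
  -- `∀y ¬…` given here, and the negated instances of that formula are literally the instances of
  -- `contractedMatrix`.
  refine ⟨hS.not_provable_starContracted hf hg hp h2.oneConsistent, fun hn => h2
    ⟨.all (.neg (.imp (.eq (.app f ![.app l ![.var 1]]) (numeral 1))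
      (.eq (.app g ![.app l ![.var 1], .app r ![.var 1], .var 0]) (numeral 1)))), ?_,
      ⟨_, ?_, rfl⟩, hn, fun z => ?_⟩⟩
  · simp [Formula.Below, Term.below_app₁, Term.below_app₃, Term.below_var, numeral_below']
  · exact ⟨trivial, trivial⟩
  · refine hS.provable_contractedMatrix_inst ?_
    by_cases hz : f.eval ![l.eval ![z]] = 1
    · obtain ⟨y, hy⟩ := hS.exists_eval_eq_one hf hg (.inr h2.oneConsistent) _ (r.eval ![z]) hz
      exact ⟨y, fun _ => hy⟩
    · exact ⟨0, fun h => absurd h hz⟩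

end

end Kripke

theorem mainTheorem2 (S : Set Kripke.Formula) (hS : Kripke.IsArithmeticalSystem S) :
    -- the predicates occurring in (*) are primitive recursive, and so is some pairing function
    (∃ f : Kripke.PR 1, Kripke.DefinesProvesPi₂ S f) ∧
    (∃ g : Kripke.PR 3, Kripke.DefinesProvesInstance S g) ∧
    (∃ (pr : Kripke.PR 2) (l r : Kripke.PR 1), Kripke.IsPairing pr l r) ∧
    ∀ (f : Kripke.PR 1) (g : Kripke.PR 3),
      Kripke.DefinesProvesPi₂ S f → Kripke.DefinesProvesInstance S g →
      -- the two-variable statement (*)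
      ((Kripke.Inconsistent S → (Kripke.star f g).IsTrue) ∧
        (Kripke.OneConsistent S →
          (Kripke.star f g).IsTrue ∧ ¬ Kripke.Provable S (Kripke.star f g)) ∧
        (Kripke.Inconsistent S ∨ Kripke.OneConsistent S →
          ∀ x₁ x₂ : ℕ, Kripke.Provable S ((Kripke.starMatrix f g).inst₂ x₁ x₂))) ∧
      -- (*) with its two universal quantifiers contracted by any pairing function
      ∀ (pr : Kripke.PR 2) (l r : Kripke.PR 1), Kripke.IsPairing pr l r →
        (Kripke.Inconsistent S → (Kripke.starContracted f g l r).IsTrue) ∧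
        (Kripke.OneConsistent S →
          (Kripke.starContracted f g l r).IsTrue ∧
            ¬ Kripke.Provable S (Kripke.starContracted f g l r)) ∧
        (Kripke.Inconsistent S ∨ Kripke.OneConsistent S →
          ∀ z : ℕ, Kripke.Provable S ((Kripke.contractedMatrix f g l r).inst z)) ∧
        (Kripke.TwoConsistent S →
          ¬ Kripke.Provable S (Kripke.starContracted f g l r) ∧
            ¬ Kripke.Provable S (.neg (Kripke.starContracted f g l r))) ∧
        (Kripke.OmegaConsistent S →
          ¬ Kripke.Provable S (Kripke.starContracted f g l r) ∧
            ¬ Kripke.Provable S (.neg (Kripke.starContracted f g l r))) ∧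
        -- the contraction is equivalent to (*) in S as soon as S proves the pairing equations,
        -- and then (*) itself is undecidable
        Kripke.Provable S (.imp (Kripke.star f g) (Kripke.starContracted f g l r)) ∧
        (Kripke.ProvesPairing S pr l r →
          Kripke.Provable S (.imp (Kripke.starContracted f g l r) (Kripke.star f g)) ∧
            (Kripke.TwoConsistent S ∨ Kripke.OmegaConsistent S →
              ¬ Kripke.Provable S (Kripke.star f g) ∧
                ¬ Kripke.Provable S (.neg (Kripke.star f g)))) := by
  open Kripke in
  refine ⟨hS.exists_definesProvesPi₂, hS.exists_definesProvesInstance, exists_isPairing,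
    fun f g hf hg => ?_⟩
  have hex := hS.exists_eval_eq_one hf hg
  have not_star : ∀ {l r : PR 1}, ¬ Provable S (starContracted f g l r) →
      ¬ Provable S (star f g) :=
    fun h h' => h (provable_star_imp_starContracted.mp h')
  -- `(*)` mentions no pairing, so its unprovability is drawn from the contraction by an auxiliary
  -- one.
  obtain ⟨pr₀, l₀, r₀, hp₀⟩ := exists_isPairing
  refine ⟨⟨fun h => star_isTrue_iff.2 (hex (.inl h)), fun h => ⟨star_isTrue_iff.2 (hex (.inr h)),
    not_star (hS.not_provable_starContracted hf hg hp₀ h)⟩,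
    fun h x₁ x₂ => hS.provable_starMatrix_inst₂ (hex h x₁ x₂)⟩, fun pr l r hp => ?_⟩
  have hexc : Inconsistent S ∨ OneConsistent S → ∀ z, ∃ y, f.eval ![l.eval ![z]] = 1 →
      g.eval ![l.eval ![z], r.eval ![z], y] = 1 := fun h z => by
    by_cases hz : f.eval ![l.eval ![z]] = 1
    · obtain ⟨y, hy⟩ := hex h _ (r.eval ![z]) hz
      exact ⟨y, fun _ => hy⟩
    · exact ⟨0, fun h => absurd h hz⟩
  have hind := hS.starContracted_independent hf hg hp
  refine ⟨fun h => starContracted_isTrue_iff.2 (hexc (.inl h)),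
    fun h => ⟨starContracted_isTrue_iff.2 (hexc (.inr h)),
      hS.not_provable_starContracted hf hg hp h⟩,
    fun h z => hS.provable_contractedMatrix_inst (hexc h z), hind,
    fun h => hind h.twoConsistent, provable_star_imp_starContracted,
    fun hpp => ⟨provable_starContracted_imp_star hpp, fun h => ?_⟩⟩
  have h2 : TwoConsistent S := h.elim id OmegaConsistent.twoConsistent
  -- A refutation of `(*)` would refute `(*)^c`, which implies `(*)` in `S` under the provable
  -- pairing equations.
  refine ⟨not_star (hind h2).1, fun hn => (hind h2).2 ?_⟩
  exact Entails.neg_intro (Γ := []) (Entails.absurd (A := star f g)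
    (Entails.mp (provable_starContracted_imp_star hpp).entails (Entails.hyp (by simp)))
    hn.entails)
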